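/- A signed graph $G=(V,E,\sigma)$ is a finite simple graph with a labelling $\sigma:E\to\{+,-\}$. It is balanced if $V$ can be split into two (possibly empty) parts such that every positive edge has both endpoints in the same part and every negative edge joins the two parts. In the bounded-degree model, $V=[N]$ with $N\ge 1$, an upper bound $d\ge 1$ on all degrees is given, and the graph is accessed through queries $(v,i)\in[N]\times[d]$: the reply is the $i$-th neighbor $w$ of $v$ (in an arbitrary fixed order) together with $\sigma(v,w)$, or an error symbol if $v$ has fewer than $i$ neighbors. $G$ is $\epsilon$-far from balanced if at least $\epsilon dN$ edge modifications (additions, removals, sign switches) are needed to make it balanced. Similarly, an unsigned graph on $n$ vertices is $\epsilon$-far from bipartite (with respect to $d$) if at least $\epsilon dn$ edge additions or removals are needed to make it bipartite. (1) There are constants $C,a,b,c$ such that for all $N\ge 1$, $d\ge 1$ and $\epsilon>0$ there is a randomized adaptive query algorithm (a probability distribution over deterministic decision trees) with the following properties on every signed graph $G$ on $[N]$ with all degrees at most $d$ and for every ordering of its adjacency lists: if $G$ is balanced, it accepts with probability $1$; if $G$ is $\epsilon$-far from balanced, it rejects with probability at least $2/3$; and it always makes at most $$C\,d^{a}\,(1+\log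 N)^{c}\,\frac{\sqrt N}{\epsilon^{b}}$$ queries. That is, balance has a one-sided tester with query complexity $\widetilde O(\sqrt N/\mathrm{poly}(\epsilon))$. (2) For a signed graph $G$ on $[N]$ with all degrees at most $d$, let $G'$ be the unsigned graph obtained by replacing every positive edge by a path of two edges through a new vertex and every negative edge by an unsigned edge. Then $G$ is balanced if and only if $G'$ is bipartite, and for every $\epsilon>0$, if $G$ is $\epsilon$-far from balanced, then $G'$ is $\frac{\epsilon}{d+1}$-far from bipartite. -/

import Mathlib

/-- A (simple, undirected) signed graph on `V`: every unordered pair of vertices carries a label,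
`0` for a non-edge, `1` for a positive edge and `-1` for a negative edge. -/
structure SignedGraph (V : Type) where
  label : Sym2 V → SignType
  loopless : ∀ v : V, label s(v, v) = 0

namespace SignedGraph

variable {V : Type}

/-- The number of neighbours of `v`. -/
noncomputable def degree (G : SignedGraph V) (v : V) : ℕ :=
  {w : V | G.label s(v, w) ≠ 0}.ncard

/-- All degrees are at most `d`. -/
def DegreeLE (G : SignedGraph V) (d : ℕ) : Prop :=
  ∀ v : V, G.degree v ≤ d

/-- The vertices split into two (possibly empty) clusters, with positive edges only inside the
clusters and negative edges only between them. -/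
def Balanced (G : SignedGraph V) : Prop :=
  ∃ cluster : V → Bool, ∀ u v : V,
    (G.label s(u, v) = 1 → cluster u = cluster v) ∧
    (G.label s(u, v) = -1 → cluster u ≠ cluster v)

/-- The number of edge modifications (additions, removals, sign switches) turning `G` into `H`. -/
noncomputable def modifications (G H : SignedGraph V) : ℕ :=
  {e : Sym2 V | G.label e ≠ H.label e}.ncard

/-- In the model with degree bound `d`, the signed graph `G` is `ε`-far from the property `P`:
at least `ε * d * |V|` edge modifications are needed to obtain a signed graph with property `P`. -/
def FarFrom (P : SignedGraph V → Prop) (d : ℕ) (ε : ℝ) (G : SignedGraph V) : Prop :=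
  ∀ H : SignedGraph V, P H → ε * d * Nat.card V ≤ G.modifications H

/-- An adjacency-list representation of `G`: for each vertex, its neighbours in some order. -/
structure AdjacencyList (G : SignedGraph V) where
  list : V → List V
  nodup : ∀ v : V, (list v).Nodup
  mem_list : ∀ v w : V, w ∈ list v ↔ G.label s(v, w) ≠ 0

/-- The reply to the query `(v, i)`: the `i`-th neighbour `w` of `v` with the sign of the edge `vw`,
or the error symbol `none` if `v` has too few neighbours (indices are counted from `0`). -/
def AdjacencyList.oracle {G : SignedGraph V} (L : G.AdjacencyList) (d : ℕ) :
    V × Fin d → Option (V × SignType) :=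
  fun q => ((L.list q.1)[(q.2 : ℕ)]?).map fun w => (w, G.label s(q.1, w))

/-- The unsigned graph obtained from `G` by replacing every positive edge by a path of two edges
through a new vertex, and keeping every negative edge. -/
def subdivision (G : SignedGraph V) : SimpleGraph (V ⊕ {e : Sym2 V // G.label e = 1}) where
  Adj
    | .inl u, .inl v => G.label s(u, v) = -1
    | .inl u, .inr e => u ∈ e.1
    | .inr e, .inl v => v ∈ e.1
    | .inr _, .inr _ => False
  symm := ⟨by
    rintro (u | e) (v | f) h
    · change G.label s(v, u) = -1
      rw [Sym2.eq_swap]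
      exact h
    · exact h
    · exact h
    · exact h⟩
  loopless := ⟨by
    rintro (v | e) h
    · change G.label s(v, v) = -1 at h
      rw [G.loopless v] at h
      exact absurd h (by decide)
    · exact h⟩

end SignedGraph

/-- In the model with degree bound `d`, the (unsigned) graph `G` is `ε`-far from bipartite:
at least `ε * d * |W|` edges have to be added or removed to make it bipartite. -/
def SimpleGraph.FarFromBipartite {W : Type} (d : ℕ) (ε : ℝ) (G : SimpleGraph W) : Prop :=
  ∀ H : SimpleGraph W, H.IsBipartite →
    ε * d * Nat.card W ≤ (symmDiff G.edgeSet H.edgeSet).ncard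

/-- Deterministic adaptive query algorithms (decision trees) with queries in `Q` and replies in `A`:
either end with a verdict (`true` is accept, `false` is reject), or make a query and continue
depending on the reply. -/
inductive DecisionTree (Q A : Type) : Type
  | leaf (verdict : Bool) : DecisionTree Q A
  | query (q : Q) (next : A → DecisionTree Q A) : DecisionTree Q A

namespace DecisionTree

variable {Q A : Type}

/-- The verdict when the queries are answered by the oracle `O`. -/
def verdict (O : Q → A) : DecisionTree Q A → Bool
  | leaf b => b
  | query q next => verdict O (next (O q))

/-- The number of queries made when the queries are answered by the oracle `O`. -/
def queryCount (O : Q → A) : DecisionTree Q A → ℕ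
  | leaf _ => 0
  | query q next => queryCount O (next (O q)) + 1

end DecisionTree

/-- A randomized query algorithm for signed graphs with `N` vertices and degree bound `d`, given by
adjacency lists: a probability distribution over deterministic query algorithms. -/
abbrev SignedGraphAlgorithm (N d : ℕ) : Type :=
  PMF (DecisionTree (Fin N × Fin d) (Option (Fin N × SignType)))

namespace SignedGraphAlgorithm

variable {N d : ℕ}

/-- The distribution of the verdict on the input given by the adjacency list `L`. -/
noncomputable def outcome (T : SignedGraphAlgorithm N d) {G : SignedGraph (Fin N)}
    (L : G.AdjacencyList) : PMF Bool :=
  PMF.map (DecisionTree.verdict (L.oracle d)) T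

/-- `T` is a one-sided tester for the property `P` with error parameter `ε`: it always accepts signed
graphs with property `P`, and rejects those that are `ε`-far from `P` with probability at least
`2/3`. -/
def IsOneSidedTester (T : SignedGraphAlgorithm N d) (P : SignedGraph (Fin N) → Prop) (ε : ℝ) :
    Prop :=
  ∀ (G : SignedGraph (Fin N)) (L : G.AdjacencyList), G.DegreeLE d →
    (P G → T.outcome L true = 1) ∧
    (SignedGraph.FarFrom P d ε G → 2 / 3 ≤ T.outcome L false)

/-- On every input of degree at most `d` and for every outcome of its randomness, `T` makes at most
`B` queries. -/
def QueryComplexityLE (T : SignedGraphAlgorithm N d) (B : ℝ) : Prop :=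
  ∀ (G : SignedGraph (Fin N)) (L : G.AdjacencyList), G.DegreeLE d →
    ∀ t ∈ T.support, (t.queryCount (L.oracle d) : ℝ) ≤ B

end SignedGraphAlgorithm

/-!
# A one-sided tester for balance of signed graphs

The tester makes lazy random walks on the double cover `V × Bool` of the signed graph, where a
negative edge changes the sheet. In a balanced graph the sheet at the end of a walk is determined by
its start and its end vertex, so two walks from the same start that reach the same vertex on different
sheets (`SignedGraph.Conflict`) prove that the graph is not balanced. The tester picks `O(1/ε)` random
starting vertices, makes `O(√N)` walks of length `poly(log N, 1/ε)` from each of them, and rejects if it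
sees a conflict.

The point is that graphs which are `ε`-far from balanced are rejected (`le_card_detecting`). Suppose that
few starting vertices are likely to see a conflict. Let `U` be a set of at least `ε N / 2` vertices, and
watch the walk only while it is over `U`, giving up on excursions that last longer than `l` steps
(`traceChain`). This is again a symmetric chain. It dominates the transition probabilities inside `U`, and
by stationarity an average start in `U` loses hardly any mass in `k ≈ log N / ε ^ 2` steps of the trace
chain (`sum_one_sub_traceChain_pow_le`). So the walk cannot escape from `U` for good, although it may
leave `U` often.

Some `s` in `U` therefore loses little mass and is unlikely to see a conflict. By the birthday paradox
(`half_le_unifProb_collision`), the two sheets of the distribution after `k` steps of the trace chain hardly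
overlap, and the difference of the two sheets is a vector with large `ℓ¹` norm. Its `ℓ²` norm is then at least of
the order `1 / √N`, so it cannot have decayed by a factor `1 - ε ^ 2 / 400` in each of the `k` steps: at some
moment its Dirichlet form was small (`exists_dirichlet_le`). A Cheeger inequality for signed graphs
(`exists_cluster_of_rayleigh_le`) turns this vector into a subset of `U` that can be clustered with few
violating edges and that has few edges to the rest of `U`. Removing such subsets greedily
(`exists_clustering_of_greedy`) shows that the graph is not `ε`-far from balanced.

For the second part, an edge that violates the clustering given by a 2-colouring of a graph on the vertices of
the subdivision accounts for a missing edge of the subdivision, which itself has at most `(d + 1) N` vertices.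
-/

/-! ### Trace chains of lazy reversible Markov chains -/

section TraceChain

open Matrix Finset

variable {X : Type*} [Fintype X] [DecidableEq X]

/-- A symmetric stochastic matrix that stays put with probability at least one half. -/
structure IsLazyReversible (p : Matrix X X ℝ) : Prop where
  symm : pᵀ = p
  nonneg : ∀ x y, 0 ≤ p x y
  row_sum : ∀ x, ∑ y, p x y = 1
  lazy : ∀ x, 1 / 2 ≤ p x x

/-- The coordinate projection onto the functions supported on `U`. -/
def coordProj (U : Finset X) : Matrix X X ℝ :=
  Matrix.diagonal fun x => if x ∈ U then 1 else 0

/-- The entry at `(x, y)` is the expected number of visits of the chain `p`, started in `x`, to `y`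
during the times `1, …, n`, where the chain is stopped when it enters `U`. -/
def excursion (p : Matrix X X ℝ) (U : Finset X) : ℕ → Matrix X X ℝ
  | 0 => 0
  | n + 1 => p + p * coordProj Uᶜ * excursion p U n

/-- The chain `p` watched only while it is in `U`, and killed when an excursion away from `U` does
not return within `l` steps. -/
def traceChain (p : Matrix X X ℝ) (U : Finset X) (l : ℕ) : Matrix X X ℝ :=
  coordProj U * excursion p U l * coordProj U

/-- The probability that the chain `p` started in `x` does not visit `U` during the times
`1, …, n`. -/
def missProb (p : Matrix X X ℝ) (U : Finset X) : ℕ → X → ℝ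
  | 0, _ => 1
  | n + 1, x => ∑ y, p x y * (if y ∈ U then 0 else missProb p U n y)

variable {p : Matrix X X ℝ} {U : Finset X}

lemma excursion_succ' (n : ℕ) :
    excursion p U (n + 1) = p + excursion p U n * coordProj Uᶜ * p := by
  induction n with
  | zero => simp [excursion]
  | succ n ih =>
    have h : excursion p U (n + 1) = p + p * coordProj Uᶜ * excursion p U n := rfl
    calc excursion p U (n + 2) = p + p * coordProj Uᶜ * excursion p U (n + 1) := rfl
      _ = p + (p + p * coordProj Uᶜ * excursion p U n) * coordProj Uᶜ * p := by
        rw [ih]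
        noncomm_ring
      _ = p + excursion p U (n + 1) * coordProj Uᶜ * p := by rw [h]

omit [Fintype X] in
lemma coordProj_transpose : (coordProj U)ᵀ = coordProj U := by
  simp [coordProj]

lemma excursion_transpose (hp : IsLazyReversible p) (n : ℕ) :
    (excursion p U n)ᵀ = excursion p U n := by
  induction n with
  | zero => simp [excursion]
  | succ n ih =>
    rw [excursion_succ']
    simp only [transpose_add, transpose_mul, hp.symm, ih, coordProj_transpose]
    rw [← excursion_succ', excursion, Matrix.mul_assoc]

lemma traceChain_transpose (hp : IsLazyReversible p) (l : ℕ) :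
    (traceChain p U l)ᵀ = traceChain p U l := by
  simp only [traceChain, transpose_mul, excursion_transpose hp, coordProj_transpose,
    Matrix.mul_assoc]

lemma excursion_succ_apply (n : ℕ) (x y : X) :
    excursion p U (n + 1) x y =
      p x y + ∑ z, p x z * (if z ∈ U then 0 else excursion p U n z y) := by
  rw [excursion, Matrix.add_apply, Matrix.mul_apply]
  congr 1
  refine Finset.sum_congr rfl fun z _ => ?_
  rw [coordProj, Matrix.mul_diagonal]
  by_cases h : z ∈ U <;> simp [h]

lemma traceChain_apply (l : ℕ) (x y : X) :
    traceChain p U l x y = if x ∈ U ∧ y ∈ U then excursion p U l x y else 0 := by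
  rw [traceChain, coordProj, Matrix.mul_diagonal, Matrix.diagonal_mul]
  by_cases hx : x ∈ U <;> by_cases hy : y ∈ U <;> simp [hx, hy]

lemma excursion_nonneg (hp : IsLazyReversible p) (n : ℕ) (x y : X) : 0 ≤ excursion p U n x y := by
  induction n generalizing x with
  | zero => simp [excursion]
  | succ n ih =>
    rw [excursion_succ_apply]
    refine add_nonneg (hp.nonneg x y) (Finset.sum_nonneg fun z _ => mul_nonneg (hp.nonneg x z) ?_)
    split_ifs
    exacts [le_rfl, ih z]

lemma traceChain_nonneg (hp : IsLazyReversible p) (l : ℕ) (x y : X) :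
    0 ≤ traceChain p U l x y := by
  rw [traceChain_apply]
  split_ifs
  exacts [excursion_nonneg hp l x y, le_rfl]

lemma le_traceChain (hp : IsLazyReversible p) {l : ℕ} (hl : 0 < l) {x y : X} (hx : x ∈ U)
    (hy : y ∈ U) : p x y ≤ traceChain p U l x y := by
  obtain ⟨n, rfl⟩ := Nat.exists_eq_succ_of_ne_zero hl.ne'
  rw [traceChain_apply, if_pos ⟨hx, hy⟩, excursion_succ_apply]
  refine le_add_of_nonneg_right (Finset.sum_nonneg fun z _ => mul_nonneg (hp.nonneg x z) ?_)
  split_ifs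
  exacts [le_rfl, excursion_nonneg hp n z y]

lemma missProb_nonneg (hp : IsLazyReversible p) (n : ℕ) (x : X) : 0 ≤ missProb p U n x := by
  induction n generalizing x with
  | zero => simp [missProb]
  | succ n ih =>
    rw [missProb]
    refine Finset.sum_nonneg fun z _ => mul_nonneg (hp.nonneg x z) ?_
    split_ifs
    exacts [le_rfl, ih z]

lemma missProb_succ_le (hp : IsLazyReversible p) (n : ℕ) (x : X) :
    missProb p U (n + 1) x ≤ missProb p U n x := by
  induction n generalizing x with
  | zero =>
    rw [missProb, missProb, ← hp.row_sum x]
    refine Finset.sum_le_sum fun z _ => ?_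
    have := hp.nonneg x z
    split_ifs <;> simp [missProb, this]
  | succ n ih =>
    rw [missProb, missProb.eq_2]
    refine Finset.sum_le_sum fun z _ => mul_le_mul_of_nonneg_left ?_ (hp.nonneg x z)
    split_ifs
    exacts [le_rfl, ih z]

/-- Entering `U` within `n` steps and missing it are complementary. -/
lemma sum_excursion_add_missProb (hp : IsLazyReversible p) (n : ℕ) (x : X) :
    ∑ y ∈ U, excursion p U n x y + missProb p U n x = 1 := by
  induction n generalizing x with
  | zero => simp [excursion, missProb]
  | succ n ih =>
    simp_rw [excursion_succ_apply, Finset.sum_add_distrib]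
    rw [Finset.sum_comm, missProb, add_assoc, ← Finset.sum_add_distrib, ← hp.row_sum x,
      ← Finset.sum_add_sum_compl U (fun y => p x y), ← Finset.sum_add_sum_compl U]
    congr 1
    rw [Finset.sum_eq_zero, zero_add]
    · refine Finset.sum_congr rfl fun z hz => ?_
      rw [Finset.mem_compl] at hz
      simp only [if_neg hz]
      rw [← Finset.mul_sum, ← mul_add, ih, mul_one]
    · intro z hz
      simp [hz]

/-- The chain is stationary, so the expected number of starting points in `U` that miss `U` for
`n` steps, summed over `n`, telescopes and is at most the number of all states. -/
lemma sum_missProb_le (hp : IsLazyReversible p) (l : ℕ) :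
    (l + 1) * ∑ x ∈ U, missProb p U l x ≤ Fintype.card X := by
  have step (n : ℕ) : ∑ x, missProb p U (n + 1) x =
      ∑ x, missProb p U n x - ∑ x ∈ U, missProb p U n x := by
    simp only [missProb]
    rw [Finset.sum_comm, ← Finset.sum_add_sum_compl U (missProb p U n), add_sub_cancel_left,
      ← Finset.sum_add_sum_compl U, Finset.sum_eq_zero, zero_add]
    · refine Finset.sum_congr rfl fun y hy => ?_
      rw [Finset.mem_compl] at hy
      rw [← Finset.sum_mul, if_neg hy]
      have : ∑ x, p x y = 1 := by
        rw [← hp.row_sum y]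
        exact Finset.sum_congr rfl fun x _ => congrFun (congrFun hp.symm y) x
      rw [this, one_mul]
    · intro y hy
      simp [hy]
  have key (n : ℕ) : n * ∑ x ∈ U, missProb p U l x ≤
      Fintype.card X - ∑ x, missProb p U n x ∨ l + 1 < n := by
    induction n with
    | zero => left; simp [missProb]
    | succ n ih =>
      by_cases hn : l + 1 < n + 1
      · exact Or.inr hn
      refine Or.inl ?_
      have h1 := ih.resolve_right (by omega)
      have hmono : Antitone fun k => ∑ x ∈ U, missProb p U k x :=
        antitone_nat_of_succ_le fun k => Finset.sum_le_sum fun x _ => missProb_succ_le hp k x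
      have h2 := hmono (show n ≤ l by omega)
      simp only at h2
      rw [step]
      push_cast
      linarith
  have h := (key (l + 1)).resolve_right (lt_irrefl _)
  have h3 : 0 ≤ ∑ x, missProb p U (l + 1) x := Finset.sum_nonneg fun x _ => missProb_nonneg hp _ x
  push_cast at h
  linarith

lemma traceChain_row_sum (l : ℕ) {x : X} (hx : x ∈ U) :
    ∑ y, traceChain p U l x y = ∑ y ∈ U, excursion p U l x y := by
  simp [traceChain_apply, hx, Finset.sum_ite_mem]

lemma traceChain_row_sum_eq (hp : IsLazyReversible p) (l : ℕ) {x : X} (hx : x ∈ U) :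
    ∑ y, traceChain p U l x y = 1 - missProb p U l x := by
  rw [traceChain_row_sum l hx, ← sum_excursion_add_missProb hp l x, add_sub_cancel_right]

lemma traceChain_row_sum_le (hp : IsLazyReversible p) (l : ℕ) (x : X) :
    ∑ y, traceChain p U l x y ≤ 1 := by
  by_cases hx : x ∈ U
  · rw [traceChain_row_sum_eq hp l hx]
    linarith [missProb_nonneg (U := U) hp l x]
  · simp [traceChain_apply, hx]

lemma traceChain_symm (hp : IsLazyReversible p) (l : ℕ) (x y : X) :
    traceChain p U l x y = traceChain p U l y x :=
  congrFun (congrFun (traceChain_transpose hp l) y) x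

lemma traceChain_pow_symm (hp : IsLazyReversible p) (l k : ℕ) (x y : X) :
    (traceChain p U l ^ k) x y = (traceChain p U l ^ k) y x := by
  have h : ((traceChain p U l) ^ k)ᵀ = traceChain p U l ^ k := by
    rw [Matrix.transpose_pow, traceChain_transpose hp]
  exact congrFun (congrFun h y) x

lemma traceChain_pow_nonneg (hp : IsLazyReversible p) (l k : ℕ) (x y : X) :
    0 ≤ (traceChain p U l ^ k) x y := by
  induction k generalizing x with
  | zero => rw [pow_zero, Matrix.one_apply]; positivity
  | succ k ih =>
    rw [pow_succ', Matrix.mul_apply]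
    exact Finset.sum_nonneg fun z _ => mul_nonneg (traceChain_nonneg hp l x z) (ih z)

lemma traceChain_pow_apply_eq_zero (l : ℕ) {k : ℕ} {x y : X} (hx : x ∈ U) (hy : y ∉ U) :
    (traceChain p U l ^ k) x y = 0 := by
  cases k with
  | zero =>
    rw [pow_zero, Matrix.one_apply_ne]
    rintro rfl
    exact hy hx
  | succ k =>
    rw [pow_succ, Matrix.mul_apply]
    exact Finset.sum_eq_zero fun z _ => by simp [traceChain_apply, hy]

lemma traceChain_pow_row_sum_le (hp : IsLazyReversible p) (l k : ℕ) (x : X) :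
    ∑ y, (traceChain p U l ^ k) x y ≤ 1 := by
  induction k generalizing x with
  | zero => simp [Matrix.one_apply]
  | succ k ih =>
    simp_rw [pow_succ', Matrix.mul_apply]
    rw [Finset.sum_comm]
    simp_rw [← Finset.mul_sum]
    refine le_trans (Finset.sum_le_sum fun z _ =>
      mul_le_of_le_one_right (traceChain_nonneg hp l x z) (ih z)) (traceChain_row_sum_le hp l x)

/-- Since the uniform measure is almost stationary, `k` steps of the trace chain lose at most `k`
times the mass lost in one step. -/
lemma sum_one_sub_traceChain_pow_le (hp : IsLazyReversible p) (l k : ℕ) :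
    ∑ x ∈ U, (1 - ∑ y, (traceChain p U l ^ k) x y) ≤ k * (Fintype.card X / (l + 1)) := by
  have hmiss : ∑ x ∈ U, missProb p U l x ≤ Fintype.card X / (l + 1) := by
    rw [le_div_iff₀ (by positivity), mul_comm]
    exact sum_missProb_le hp l
  induction k with
  | zero => simp [Matrix.one_apply]
  | succ k ih =>
    have h : ∑ x ∈ U, ∑ y, (traceChain p U l ^ (k + 1)) x y =
        ∑ z ∈ U, (1 - missProb p U l z) * ∑ y, (traceChain p U l ^ k) z y := by
      simp_rw [pow_succ', Matrix.mul_apply]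
      have h1 : ∀ x, ∑ y, ∑ z, traceChain p U l x z * (traceChain p U l ^ k) z y =
          ∑ z, traceChain p U l x z * ∑ y, (traceChain p U l ^ k) z y := fun x => by
        rw [Finset.sum_comm]
        simp_rw [Finset.mul_sum]
      simp_rw [h1]
      rw [Finset.sum_comm, ← Finset.sum_add_sum_compl U]
      rw [Finset.sum_eq_zero (s := Uᶜ), add_zero]
      · refine Finset.sum_congr rfl fun z hz => ?_
        rw [← Finset.sum_mul, ← traceChain_row_sum_eq hp l hz]
        congr 1
        simp_rw [traceChain_symm hp l z]
        refine (Finset.sum_subset (Finset.subset_univ U) fun x _ hx => ?_)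
        simp [traceChain_apply, hx]
      · intro z hz
        rw [Finset.mem_compl] at hz
        simp [traceChain_apply, hz]
    rw [Finset.sum_sub_distrib, h]
    rw [Finset.sum_sub_distrib] at ih
    have h2 : ∑ z ∈ U, ∑ y, (traceChain p U l ^ k) z y - ∑ z ∈ U, missProb p U l z ≤
        ∑ z ∈ U, (1 - missProb p U l z) * ∑ y, (traceChain p U l ^ k) z y := by
      rw [← Finset.sum_sub_distrib]
      refine Finset.sum_le_sum fun z _ => ?_
      nlinarith [traceChain_pow_row_sum_le (U := U) hp l k z, missProb_nonneg (U := U) hp l z]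
    push_cast
    linarith

/-- A weighted average with at least half of the weight at `x` satisfies Jensen's inequality for
squares with a gain. -/
lemma sq_sum_mul_le_of_half_le (b f : X → ℝ) (hb : ∀ y, 0 ≤ b y) (hb1 : ∑ y, b y ≤ 1) (x : X)
    (hx : 1 / 2 ≤ b x) :
    (∑ y, b y * f y) ^ 2 ≤ ∑ y, b y * f y ^ 2 - 1 / 2 * ∑ y, b y * (f x - f y) ^ 2 := by
  set r := ∑ y, b y with hr
  set g : X → ℝ := fun y => f y - f x with hg
  set G := ∑ y, b y * g y with hG
  set G2 := ∑ y, b y * g y ^ 2 with hG2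
  have e1 : ∑ y, b y * f y = r * f x + G := by
    rw [hr, hG, Finset.sum_mul, ← Finset.sum_add_distrib]
    exact Finset.sum_congr rfl fun y _ => by simp only [hg]; ring
  have e2 : ∑ y, b y * f y ^ 2 = r * f x ^ 2 + 2 * f x * G + G2 := by
    rw [hr, hG, hG2, Finset.sum_mul, Finset.mul_sum, ← Finset.sum_add_distrib,
      ← Finset.sum_add_distrib]
    exact Finset.sum_congr rfl fun y _ => by simp only [hg]; ring
  have e3 : ∑ y, b y * (f x - f y) ^ 2 = G2 :=
    Finset.sum_congr rfl fun y _ => by simp only [hg]; ring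
  have hcs : G ^ 2 ≤ (r - 1 / 2) * G2 := by
    have h1 : G = ∑ y ∈ univ.erase x, b y * g y := by
      rw [hG, ← Finset.add_sum_erase univ _ (Finset.mem_univ x)]
      simp [hg]
    have h2 : G2 = ∑ y ∈ univ.erase x, b y * g y ^ 2 := by
      rw [hG2, ← Finset.add_sum_erase univ _ (Finset.mem_univ x)]
      simp [hg]
    have h3 : ∑ y ∈ univ.erase x, b y ≤ r - 1 / 2 := by
      have := Finset.add_sum_erase univ b (Finset.mem_univ x)
      rw [← hr] at this
      linarith
    have h4 : G ^ 2 ≤ (∑ y ∈ univ.erase x, b y) * ∑ y ∈ univ.erase x, b y * g y ^ 2 := by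
      rw [h1]
      refine Finset.sum_sq_le_sum_mul_sum_of_sq_le_mul _ (fun y _ => hb y)
        (fun y _ => mul_nonneg (hb y) (sq_nonneg _)) fun y _ => le_of_eq (by ring)
    have h5 : 0 ≤ G2 := Finset.sum_nonneg fun y _ => mul_nonneg (hb y) (sq_nonneg _)
    rw [← h2] at h4
    exact h4.trans (mul_le_mul_of_nonneg_right h3 h5)
  have h6 : 0 ≤ r * f x ^ 2 + 2 * f x * G + G2 := by
    rw [← e2]
    exact Finset.sum_nonneg fun y _ => mul_nonneg (hb y) (sq_nonneg _)
  rw [e1, e2, e3]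
  nlinarith [mul_nonneg (sub_nonneg.2 hb1) h6]

/-- One step of the trace chain decreases the squared norm by at least half the Dirichlet form. -/
lemma sum_sq_traceChain_mulVec_le (hp : IsLazyReversible p) {l : ℕ} (hl : 0 < l) (F : X → ℝ) :
    ∑ x, (traceChain p U l *ᵥ F) x ^ 2 ≤
      ∑ x, F x ^ 2 - 1 / 2 * ∑ x ∈ U, ∑ y ∈ U, p x y * (F x - F y) ^ 2 := by
  have h0 : ∑ x, (traceChain p U l *ᵥ F) x ^ 2 = ∑ x ∈ U, (traceChain p U l *ᵥ F) x ^ 2 := by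
    refine (Finset.sum_subset (Finset.subset_univ U) fun x _ hx => ?_).symm
    simp [Matrix.mulVec, dotProduct, traceChain_apply, hx]
  have h1 : ∀ x ∈ U, (traceChain p U l *ᵥ F) x ^ 2 ≤ ∑ y, traceChain p U l x y * F y ^ 2 -
      1 / 2 * ∑ y ∈ U, p x y * (F x - F y) ^ 2 := fun x hx => by
    refine (sq_sum_mul_le_of_half_le (traceChain p U l x) F (traceChain_nonneg hp l x)
      (traceChain_row_sum_le hp l x) x ((hp.lazy x).trans (le_traceChain hp hl hx hx))).trans ?_
    have : ∑ y ∈ U, p x y * (F x - F y) ^ 2 ≤ ∑ y, traceChain p U l x y * (F x - F y) ^ 2 := by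
      refine (Finset.sum_le_sum fun y hy => mul_le_mul_of_nonneg_right
        (le_traceChain hp hl hx hy) (sq_nonneg _)).trans ?_
      exact Finset.sum_le_sum_of_subset_of_nonneg (Finset.subset_univ U) fun y _ _ =>
        mul_nonneg (traceChain_nonneg hp l x y) (sq_nonneg _)
    linarith
  rw [h0]
  refine (Finset.sum_le_sum h1).trans ?_
  rw [Finset.sum_sub_distrib, ← Finset.mul_sum]
  refine sub_le_sub_right ?_ _
  rw [Finset.sum_comm]
  refine Finset.sum_le_sum fun y _ => ?_
  rw [← Finset.sum_mul]
  refine mul_le_of_le_one_left (sq_nonneg _) ?_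
  simp_rw [traceChain_symm hp l _ y]
  exact (Finset.sum_le_sum_of_subset_of_nonneg (Finset.subset_univ U) fun x _ _ =>
    traceChain_nonneg hp l y x).trans (traceChain_row_sum_le hp l y)

/-- If the squared norm of a vector has not decayed exponentially under the trace chain, then at
some moment its Dirichlet form on `U` was small. -/
lemma exists_dirichlet_le (hp : IsLazyReversible p) {l : ℕ} (hl : 0 < l) (F : X → ℝ) {η : ℝ}
    (hη1 : η ≤ 1) (k : ℕ)
    (hF : (1 - η) ^ k * ∑ x, F x ^ 2 < ∑ x, ((traceChain p U l ^ k) *ᵥ F) x ^ 2) :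
    ∃ j, 0 < ∑ x, ((traceChain p U l ^ j) *ᵥ F) x ^ 2 ∧
      ∑ x ∈ U, ∑ y ∈ U, p x y * (((traceChain p U l ^ j) *ᵥ F) x -
        ((traceChain p U l ^ j) *ᵥ F) y) ^ 2 ≤
      2 * η * ∑ x, ((traceChain p U l ^ j) *ᵥ F) x ^ 2 := by
  by_contra! hcon
  have hstep (j : ℕ) : ∑ x, ((traceChain p U l ^ (j + 1)) *ᵥ F) x ^ 2 ≤
      (1 - η) * ∑ x, ((traceChain p U l ^ j) *ᵥ F) x ^ 2 := by
    have h := sum_sq_traceChain_mulVec_le (U := U) hp hl ((traceChain p U l ^ j) *ᵥ F)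
    rw [Matrix.mulVec_mulVec, ← pow_succ'] at h
    rcases (Finset.sum_nonneg fun x _ => sq_nonneg (((traceChain p U l ^ j) *ᵥ F) x)).eq_or_lt
      with h0 | h0
    · rw [← h0, mul_zero]
      rw [← h0] at h
      have : 0 ≤ ∑ x ∈ U, ∑ y ∈ U, p x y * (((traceChain p U l ^ j) *ᵥ F) x -
        ((traceChain p U l ^ j) *ᵥ F) y) ^ 2 := Finset.sum_nonneg fun x _ =>
          Finset.sum_nonneg fun y _ => mul_nonneg (hp.nonneg x y) (sq_nonneg _)
      linarith
    · have := hcon j h0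
      linarith
  have hall (j : ℕ) : ∑ x, ((traceChain p U l ^ j) *ᵥ F) x ^ 2 ≤
      (1 - η) ^ j * ∑ x, F x ^ 2 := by
    induction j with
    | zero => simp
    | succ j ih =>
      refine (hstep j).trans ?_
      rw [pow_succ', mul_assoc]
      exact mul_le_mul_of_nonneg_left ih (by linarith)
  exact absurd (hall k) (not_le.2 hF)

end TraceChain

/-! ### Uniform probabilities and the birthday paradox -/

section Birthday

open Finset Classical
open scoped BigOperators

variable {Ω : Type*} [Fintype Ω]

/-- The probability of the event `E` under the uniform distribution on a finite type. -/
noncomputable def unifProb (E : Ω → Prop) : ℝ :=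
  𝔼 ω, if E ω then 1 else 0

lemma expect_ite_one (E : Ω → Prop) [DecidablePred E] :
    𝔼 ω, (if E ω then (1 : ℝ) else 0) = unifProb E := by
  rw [unifProb]
  congr!

lemma unifProb_nonneg (E : Ω → Prop) : 0 ≤ unifProb E :=
  Finset.expect_nonneg fun ω _ => by split_ifs <;> norm_num

lemma unifProb_mono {E F : Ω → Prop} (h : ∀ ω, E ω → F ω) : unifProb E ≤ unifProb F := by
  refine Finset.expect_le_expect fun ω _ => ?_
  by_cases hE : E ω
  · simp [hE, h ω hE]
  · simp only [hE, if_false]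
    split_ifs <;> norm_num

lemma unifProb_not [Nonempty Ω] (E : Ω → Prop) : unifProb (fun ω => ¬ E ω) = 1 - unifProb E := by
  rw [eq_sub_iff_add_eq, unifProb, unifProb, ← Finset.expect_add_distrib,
    ← Fintype.expect_const (ι := Ω) (1 : ℝ)]
  refine Finset.expect_congr rfl fun ω _ => ?_
  by_cases h : E ω <;> simp [h]

lemma unifProb_le_one [Nonempty Ω] (E : Ω → Prop) : unifProb E ≤ 1 := by
  have h1 := unifProb_not E
  have h2 := unifProb_nonneg fun ω => ¬ E ω
  linarith

lemma unifProb_eq_card_div (E : Ω → Prop) [DecidablePred E] :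
    unifProb E = (#{ω | E ω} : ℝ) / Fintype.card Ω := by
  rw [← expect_ite_one, Fintype.expect_eq_sum_div_card]
  simp

lemma unifProb_prod {Ω' : Type*} [Fintype Ω'] (E : Ω × Ω' → Prop) :
    unifProb E = 𝔼 ω, unifProb fun ω' => E (ω, ω') := by
  simp only [unifProb]
  rw [← Finset.univ_product_univ, Finset.expect_product]

lemma expect_fin_cons {n : ℕ} (f : (Fin (n + 1) → Ω) → ℝ) :
    𝔼 ω, f ω = 𝔼 a, 𝔼 ω : Fin n → Ω, f (Fin.cons a ω : Fin (n + 1) → Ω) := by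
  rw [← Finset.expect_product', Finset.univ_product_univ]
  refine (Fintype.expect_equiv (Fin.consEquiv fun _ => Ω) _ _ fun x => rfl).symm

lemma unifProb_forall (n : ℕ) (E : Ω → Prop) :
    unifProb (fun ω : Fin n → Ω => ∀ i, E (ω i)) = unifProb E ^ n := by
  induction n with
  | zero => simp [unifProb]
  | succ n ih =>
    rw [unifProb, expect_fin_cons, pow_succ', ← ih]
    simp only [unifProb]
    rw [Finset.expect_mul]
    refine Finset.expect_congr rfl fun a _ => ?_
    rw [Finset.mul_expect]
    refine Finset.expect_congr rfl fun ω _ => ?_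
    by_cases h : E a <;> simp [Fin.forall_fin_succ, h]

variable {V : Type*} [Fintype V]

omit [Fintype V] in
lemma unifProb_exists_mem (f : Ω → Option V) (S : Finset V) :
    unifProb (fun ω => ∃ v ∈ S, f ω = some v) = ∑ v ∈ S, unifProb fun ω => f ω = some v := by
  simp only [unifProb]
  rw [← Finset.expect_sum_comm]
  refine Finset.expect_congr rfl fun ω _ => ?_
  by_cases h : ∃ v ∈ S, f ω = some v
  · obtain ⟨v, hv, hfv⟩ := h
    rw [if_pos ⟨v, hv, hfv⟩, Finset.sum_eq_single_of_mem v hv, if_pos hfv]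
    intro w _ hw
    exact if_neg fun h => hw (Option.some.inj (hfv.symm.trans h)).symm
  · rw [if_neg h, Finset.sum_eq_zero]
    exact fun v hv => if_neg fun hfv => h ⟨v, hv, hfv⟩

/-- The set of values attained by `f` on a sample. -/
noncomputable def hits (f : Ω → Option V) {n : ℕ} (ω : Fin n → Ω) : Finset V :=
  {v | ∃ i, f (ω i) = some v}

omit [Fintype Ω] in
lemma hits_cons (f : Ω → Option V) {n : ℕ} (a : Ω) (ω : Fin n → Ω) :
    hits f (Fin.cons a ω : Fin (n + 1) → Ω) = (f a).toFinset ∪ hits f ω := by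
  ext v
  simp [hits, Fin.exists_fin_succ, Option.mem_toFinset, Option.mem_def]

/-- As long as little mass is collected, one more sample collects an additional `δ` with
probability at least `1 / 32`. -/
lemma expect_exp_neg_sum_le [Nonempty Ω] (f : Ω → Option V) (m : V → ℝ) (hm : ∀ v, 0 ≤ m v)
    (hf : ∀ v, m v ≤ unifProb fun ω => f ω = some v) {δ : ℝ}
    (hδ : 1 / 16 ≤ ∑ v with δ ≤ m v, m v) {κ : ℝ} (hκ : 0 ≤ κ) (P : Finset V)
    (hP : ∑ v ∈ P, m v < 1 / 32) (hδ0 : 0 ≤ δ) :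
    𝔼 a, Real.exp (-κ * ∑ v ∈ P ∪ (f a).toFinset, m v) ≤
      (1 - (1 - Real.exp (-κ * δ)) / 32) * Real.exp (-κ * ∑ v ∈ P, m v) := by
  set S : Finset V := (univ.filter fun v => δ ≤ m v) \ P with hS
  have hSm : 1 / 32 ≤ unifProb fun ω => ∃ v ∈ S, f ω = some v := by
    rw [unifProb_exists_mem]
    refine le_trans ?_ (Finset.sum_le_sum fun v _ => hf v)
    have h1 : ∑ v with δ ≤ m v, m v ≤ ∑ v ∈ S ∪ P, m v := by
      refine Finset.sum_le_sum_of_subset_of_nonneg ?_ fun v _ _ => hm v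
      rw [hS, Finset.sdiff_union_self_eq_union]
      exact Finset.subset_union_left
    have h2 : ∑ v ∈ S ∪ P, m v = ∑ v ∈ S, m v + ∑ v ∈ P, m v :=
      Finset.sum_union (Finset.sdiff_disjoint)
    linarith
  have hpt : ∀ a, Real.exp (-κ * ∑ v ∈ P ∪ (f a).toFinset, m v) ≤
      Real.exp (-κ * ∑ v ∈ P, m v) - (1 - Real.exp (-κ * δ)) * Real.exp (-κ * ∑ v ∈ P, m v) *
        (if ∃ v ∈ S, f a = some v then 1 else 0) := by
    intro a
    split_ifs with h
    · obtain ⟨v, hv, hav⟩ := h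
      rw [hS, Finset.mem_sdiff, Finset.mem_filter] at hv
      have : ∑ w ∈ P ∪ (f a).toFinset, m w = ∑ w ∈ P, m w + m v := by
        rw [hav, Option.toFinset_some, Finset.sum_union (by simpa using hv.2),
          Finset.sum_singleton]
      have h2 : Real.exp (-κ * ∑ v ∈ P, m v) - (1 - Real.exp (-κ * δ)) *
          Real.exp (-κ * ∑ v ∈ P, m v) * 1 = Real.exp (-κ * δ + -κ * ∑ v ∈ P, m v) := by
        rw [Real.exp_add]; ring
      rw [this, h2]
      refine Real.exp_le_exp.2 ?_
      nlinarith [hv.1.2]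
    · rw [mul_zero, sub_zero]
      refine Real.exp_le_exp.2 ?_
      have : ∑ v ∈ P, m v ≤ ∑ v ∈ P ∪ (f a).toFinset, m v :=
        Finset.sum_le_sum_of_subset_of_nonneg Finset.subset_union_left fun v _ _ => hm v
      nlinarith
  refine (Finset.expect_le_expect fun a _ => hpt a).trans ?_
  rw [Finset.expect_sub_distrib, Fintype.expect_const, ← Finset.mul_expect]
  have he : 0 ≤ (1 - Real.exp (-κ * δ)) * Real.exp (-κ * ∑ v ∈ P, m v) := by
    refine mul_nonneg ?_ (Real.exp_pos _).le
    rw [sub_nonneg, Real.exp_le_one_iff]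
    nlinarith
  rw [expect_ite_one]
  have := mul_le_mul_of_nonneg_left hSm he
  linarith

/-- The mass collected by a sample is large with high probability, in an exponential sense. -/
lemma expect_exp_neg_hits_le [Nonempty Ω] (f : Ω → Option V) (m : V → ℝ) (hm : ∀ v, 0 ≤ m v)
    (hf : ∀ v, m v ≤ unifProb fun ω => f ω = some v) {δ : ℝ}
    (hδ : 1 / 16 ≤ ∑ v with δ ≤ m v, m v) {κ : ℝ} (hκ : 0 ≤ κ) (hδ0 : 0 ≤ δ) (n : ℕ)
    (P : Finset V) :
    𝔼 ω : Fin n → Ω, Real.exp (-κ * ∑ v ∈ P ∪ hits f ω, m v) ≤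
      (1 - (1 - Real.exp (-κ * δ)) / 32) ^ n * Real.exp (-κ * ∑ v ∈ P, m v) +
        Real.exp (-κ / 32) := by
  induction n generalizing P with
  | zero =>
    have : ∀ ω : Fin 0 → Ω, hits f ω = ∅ := fun ω => by simp [hits]
    simp only [this, Finset.union_empty, pow_zero, one_mul, Fintype.expect_const]
    linarith [Real.exp_pos (-κ / 32)]
  | succ n ih =>
    set ρ := 1 - (1 - Real.exp (-κ * δ)) / 32 with hρ
    have hρ0 : 0 ≤ ρ := by linarith [Real.exp_pos (-κ * δ)]
    by_cases hP : ∑ v ∈ P, m v < 1 / 32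
    · rw [expect_fin_cons]
      have h1 : ∀ a, 𝔼 ω : Fin n → Ω, Real.exp (-κ * ∑ v ∈ P ∪ hits f
          (Fin.cons a ω : Fin (n + 1) → Ω), m v) ≤
          ρ ^ n * Real.exp (-κ * ∑ v ∈ P ∪ (f a).toFinset, m v) + Real.exp (-κ / 32) := by
        intro a
        simp_rw [hits_cons, ← Finset.union_assoc]
        exact ih _
      refine (Finset.expect_le_expect fun a _ => h1 a).trans ?_
      rw [Finset.expect_add_distrib, Fintype.expect_const, ← Finset.mul_expect, pow_succ, mul_assoc]
      have := mul_le_mul_of_nonneg_left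
        (expect_exp_neg_sum_le f m hm hf hδ hκ P hP hδ0) (pow_nonneg hρ0 n)
      rw [← hρ] at this
      linarith
    · have h2 : 0 ≤ ρ ^ (n + 1) * Real.exp (-κ * ∑ v ∈ P, m v) := by positivity
      refine le_trans (Finset.expect_le Finset.univ_nonempty fun ω _ => ?_)
        (le_add_of_nonneg_left h2)
      refine Real.exp_le_exp.2 ?_
      have : ∑ v ∈ P, m v ≤ ∑ v ∈ P ∪ hits f ω, m v :=
        Finset.sum_le_sum_of_subset_of_nonneg Finset.subset_union_left fun v _ _ => hm v
      nlinarith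

/-- If the distributions of `f` and `g` overlap in a constant mass, then two samples whose size is
a suitable multiple of the square root of the number of values share a value with constant
probability. -/
lemma half_le_unifProb_collision [Nonempty Ω] (f g : Ω → Option V) (m : V → ℝ)
    (hm : ∀ v, 0 ≤ m v) (hf : ∀ v, m v ≤ unifProb fun ω => f ω = some v)
    (hg : ∀ v, m v ≤ unifProb fun ω => g ω = some v) (hsum : 1 / 8 ≤ ∑ v, m v) {n : ℕ}
    (hn : 0 < n) (hnV : Fintype.card V ≤ n ^ 2) :
    1 / 2 ≤ unifProb fun ω : (Fin (128 * n) → Ω) × (Fin (128 * n) → Ω) =>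
      ∃ i j v, f (ω.1 i) = some v ∧ g (ω.2 j) = some v := by
  set K := 128 * n with hK
  have hV : 0 < Fintype.card V := by
    rw [Fintype.card_pos_iff]
    by_contra h
    rw [not_nonempty_iff] at h
    norm_num [Finset.univ_eq_empty] at hsum
  have hVr : (0 : ℝ) < Fintype.card V := by exact_mod_cast hV
  have hnr : (1 : ℝ) ≤ n := by exact_mod_cast hn
  have hnVr : (Fintype.card V : ℝ) ≤ n ^ 2 := by exact_mod_cast hnV
  have hKr : (K : ℝ) = 128 * n := by rw [hK]; push_cast; ring
  -- the values of mass below `δ` contribute at most `1 / 16` to the overlap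
  set δ : ℝ := 1 / (16 * Fintype.card V) with hδd
  have hδ0 : 0 < δ := by positivity
  have hδ : 1 / 16 ≤ ∑ v with δ ≤ m v, m v := by
    have h1 := Finset.sum_filter_add_sum_filter_not univ (fun v => δ ≤ m v) m
    have h2 : ∑ v with ¬ δ ≤ m v, m v ≤ ∑ v : V, δ := by
      refine (Finset.sum_le_sum (g := fun _ => δ) fun v hv => ?_).trans
        (Finset.sum_le_sum_of_subset_of_nonneg (Finset.subset_univ _) fun _ _ _ => hδ0.le)
      rw [Finset.mem_filter] at hv
      exact (not_le.1 hv.2).le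
    have h3 : ∑ v : V, δ = 1 / 16 := by
      rw [Finset.sum_const, Finset.card_univ, nsmul_eq_mul, hδd]
      field_simp
    linarith
  have hno : unifProb (fun ω : (Fin K → Ω) × (Fin K → Ω) =>
      ¬ ∃ i j v, f (ω.1 i) = some v ∧ g (ω.2 j) = some v) ≤
      𝔼 ω : Fin K → Ω, Real.exp (-(K : ℝ) * ∑ v ∈ ∅ ∪ hits f ω, m v) := by
    rw [unifProb_prod]
    refine Finset.expect_le_expect fun ω _ => ?_
    have h1 : ∀ ω' : Fin K → Ω, (¬ ∃ i j v, f (ω i) = some v ∧ g (ω' j) = some v) ↔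
        ∀ j, ¬ ∃ v ∈ hits f ω, g (ω' j) = some v := fun ω' => by
      simp only [hits, Finset.mem_filter, Finset.mem_univ, true_and]
      constructor
      · rintro h j ⟨v, ⟨i, hi⟩, hj⟩
        exact h ⟨i, j, v, hi, hj⟩
      · rintro h ⟨i, j, v, hi, hj⟩
        exact h j ⟨v, ⟨i, hi⟩, hj⟩
    simp only [h1]
    rw [unifProb_forall K (fun a => ¬ ∃ v ∈ hits f ω, g a = some v), unifProb_not,
      Finset.empty_union, neg_mul, ← mul_neg, Real.exp_nat_mul]
    refine pow_le_pow_left₀ (sub_nonneg.2 (unifProb_le_one _)) ?_ K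
    rw [unifProb_exists_mem]
    have h2 : ∑ v ∈ hits f ω, m v ≤ ∑ v ∈ hits f ω, unifProb fun ω => g ω = some v :=
      Finset.sum_le_sum fun v _ => hg v
    have h3 := Real.add_one_le_exp (-∑ v ∈ hits f ω, m v)
    linarith
  have hup := hno.trans
    (expect_exp_neg_hits_le f m hm hf hδ (Nat.cast_nonneg K) hδ0.le K ∅)
  rw [unifProb_not, Finset.sum_empty, mul_zero, Real.exp_zero, mul_one] at hup
  have e1 : Real.exp (-(K : ℝ) / 32) ≤ 1 / 4 := by
    have h : Real.exp (-(K : ℝ) / 32) ≤ Real.exp (-3) := Real.exp_le_exp.2 (by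
      rw [hKr]; linarith)
    have h2 : (4 : ℝ) ≤ Real.exp 3 := by linarith [Real.add_one_le_exp (3 : ℝ)]
    rw [Real.exp_neg] at h
    exact h.trans (by rw [one_div]; exact inv_anti₀ (by norm_num) h2)
  have e2 : (1 - (1 - Real.exp (-(K : ℝ) * δ)) / 32) ^ K ≤ 1 / 4 := by
    set x := (K : ℝ) * δ with hx
    have hx0 : 0 ≤ x := by positivity
    have h1 : x / (1 + x) ≤ 1 - Real.exp (-(K : ℝ) * δ) := by
      have h2 : Real.exp (-(K : ℝ) * δ) ≤ 1 / (1 + x) := by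
        rw [neg_mul, Real.exp_neg, one_div]
        exact inv_anti₀ (by positivity) (by linarith [Real.add_one_le_exp x])
      have h3 : x / (1 + x) = 1 - 1 / (1 + x) := by field_simp; ring
      linarith
    have h4 : 1 - (1 - Real.exp (-(K : ℝ) * δ)) / 32 ≤ Real.exp (-(x / (1 + x) / 32)) := by
      have := Real.add_one_le_exp (-(x / (1 + x) / 32))
      linarith
    have h0 : 0 ≤ 1 - (1 - Real.exp (-(K : ℝ) * δ)) / 32 := by
      linarith [Real.exp_pos (-(K : ℝ) * δ)]
    refine (pow_le_pow_left₀ h0 h4 K).trans ?_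
    rw [← Real.exp_nat_mul]
    have h5 : 3 ≤ K * (x / (1 + x) / 32) := by
      have hxe : x = 8 * n / Fintype.card V := by
        rw [hx, hKr, hδd]; field_simp; norm_num
      have : K * (x / (1 + x) / 32) = 32 * n ^ 2 / (Fintype.card V + 8 * n) := by
        rw [hxe, hKr]; field_simp; norm_num
      rw [this, le_div_iff₀ (by positivity)]
      nlinarith
    have h6 : (4 : ℝ) ≤ Real.exp 3 := by linarith [Real.add_one_le_exp (3 : ℝ)]
    have h7 : Real.exp (K * -(x / (1 + x) / 32)) ≤ Real.exp (-3) :=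
      Real.exp_le_exp.2 (by linarith)
    rw [Real.exp_neg] at h7
    exact h7.trans (by rw [one_div]; exact inv_anti₀ (by norm_num) h6)
  linarith

end Birthday

/-! ### The random walk on the double cover of a signed graph -/

namespace SignedGraph

open Finset Classical
open scoped BigOperators

variable {V : Type}

/-- The effect of a reply of the oracle on a vertex of the double cover `V × Bool`: move to the
neighbour in the reply, and change the sheet exactly if the edge is negative. -/
def follow (r : Option (V × SignType)) (x : V × Bool) : V × Bool :=
  match r with
  | none => x
  | some (w, σ) => (w, xor x.2 (decide (σ = -1)))

/-- One step of the lazy random walk on the double cover. The random choice `i` consists of a coin,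
which decides whether to stay, and an index in the adjacency list; the walk also stays if the list
is too short for the index. -/
def walkStep {d : ℕ} (O : V × Fin d → Option (V × SignType)) (i : Bool × Fin d) (x : V × Bool) :
    V × Bool :=
  if i.1 then follow (O (x.1, i.2)) x else x

/-- Exchange of the two sheets of the double cover. -/
def flip (x : V × Bool) : V × Bool := (x.1, !x.2)

lemma flip_flip (x : V × Bool) : flip (flip x) = x := by simp [flip]

lemma follow_flip (r : Option (V × SignType)) (x : V × Bool) :
    follow r (flip x) = flip (follow r x) := by
  rcases r with _ | ⟨w, σ⟩ <;> simp [follow, flip]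

lemma walkStep_flip {d : ℕ} (O : V × Fin d → Option (V × SignType)) (i : Bool × Fin d)
    (x : V × Bool) : walkStep O i (flip x) = flip (walkStep O i x) := by
  unfold walkStep
  split_ifs
  · exact follow_flip _ _
  · rfl

/-- The edges of the double cover. -/
def CoverAdj (G : SignedGraph V) (x y : V × Bool) : Prop :=
  G.label s(x.1, y.1) ≠ 0 ∧ y.2 = xor x.2 (decide (G.label s(x.1, y.1) = -1))

lemma CoverAdj.symm {G : SignedGraph V} {x y : V × Bool} (h : G.CoverAdj x y) :
    G.CoverAdj y x := by
  obtain ⟨h1, h2⟩ := h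
  refine ⟨by rwa [Sym2.eq_swap], ?_⟩
  rw [Sym2.eq_swap, h2]
  simp

variable {G : SignedGraph V} (L : G.AdjacencyList) {d : ℕ}

lemma AdjacencyList.length_le [Finite V] (hd : G.DegreeLE d) (v : V) : (L.list v).length ≤ d := by
  refine le_trans (le_of_eq ?_) (hd v)
  rw [degree, ← List.toFinset_card_of_nodup (L.nodup v), ← Set.ncard_coe_finset]
  congr 1
  ext w
  simp [L.mem_list]

lemma follow_oracle_eq_iff {x y : V × Bool} (hxy : x ≠ y) (i : Fin d) :
    follow (L.oracle d (x.1, i)) x = y ↔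
      (L.list x.1)[(i : ℕ)]? = some y.1 ∧
        y.2 = xor x.2 (decide (G.label s(x.1, y.1) = -1)) := by
  rw [AdjacencyList.oracle]
  rcases h : (L.list x.1)[(i : ℕ)]? with _ | w
  · simp [follow, hxy]
  · simp only [Option.map_some, follow, Prod.ext_iff, Option.some.injEq]
    constructor
    · rintro ⟨rfl, h2⟩
      exact ⟨rfl, h2.symm⟩
    · rintro ⟨h1, h2⟩
      rw [h1]
      exact ⟨rfl, h2.symm⟩

/-- The transition matrix of the lazy random walk on the double cover. -/
noncomputable def walkMatrix (d : ℕ) : Matrix (V × Bool) (V × Bool) ℝ := fun x y =>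
  unifProb fun i : Bool × Fin d => walkStep (L.oracle d) i x = y

lemma walkMatrix_apply_of_ne [Finite V] (hd : G.DegreeLE d) {x y : V × Bool} (hxy : x ≠ y) :
    walkMatrix L d x y = if G.CoverAdj x y then 1 / (2 * d : ℝ) else 0 := by
  rw [walkMatrix, unifProb_eq_card_div]
  have hstep : ∀ i : Bool × Fin d, walkStep (L.oracle d) i x = y ↔
      i.1 = true ∧ (L.list x.1)[(i.2 : ℕ)]? = some y.1 ∧
        y.2 = xor x.2 (decide (G.label s(x.1, y.1) = -1)) := by
    rintro ⟨b, i⟩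
    cases b
    · simp [walkStep, hxy]
    · simp [walkStep, follow_oracle_eq_iff L hxy]
  simp only [hstep, Fintype.card_prod, Fintype.card_bool, Fintype.card_fin]
  split_ifs with h
  · obtain ⟨h1, h2⟩ := h
    obtain ⟨j, hj, hjy⟩ := List.getElem_of_mem ((L.mem_list _ _).2 h1)
    have hcard : #{i : Bool × Fin d | i.1 = true ∧ (L.list x.1)[(i.2 : ℕ)]? = some y.1 ∧
        y.2 = xor x.2 (decide (G.label s(x.1, y.1) = -1))} = 1 := by
      rw [Finset.card_eq_one]
      refine ⟨(true, ⟨j, hj.trans_le (L.length_le hd _)⟩), ?_⟩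
      ext ⟨b, i⟩
      simp only [Finset.mem_filter, Finset.mem_univ, true_and, Finset.mem_singleton, Prod.ext_iff,
        Fin.ext_iff]
      constructor
      · rintro ⟨hb, hi, -⟩
        refine ⟨hb, ?_⟩
        rw [List.getElem?_eq_some_iff] at hi
        obtain ⟨hi, hiy⟩ := hi
        exact (L.nodup x.1).getElem_inj_iff.1 (hiy.trans hjy.symm)
      · rintro ⟨hb, hi⟩
        refine ⟨hb, ?_, h2⟩
        rw [hi, List.getElem?_eq_some_iff]
        exact ⟨hj, hjy⟩
    rw [hcard]
    push_cast
    rfl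
  · have hcard : #{i : Bool × Fin d | i.1 = true ∧ (L.list x.1)[(i.2 : ℕ)]? = some y.1 ∧
        y.2 = xor x.2 (decide (G.label s(x.1, y.1) = -1))} = 0 := by
      rw [Finset.card_eq_zero, Finset.filter_eq_empty_iff]
      rintro ⟨b, i⟩ - ⟨-, hi, h2⟩
      exact h ⟨(L.mem_list _ _).1 (List.mem_of_getElem? hi), h2⟩
    rw [hcard]
    simp

lemma walkMatrix_of_coverAdj [Finite V] (hd : G.DegreeLE d) {x y : V × Bool}
    (h : G.CoverAdj x y) : walkMatrix L d x y = 1 / (2 * d : ℝ) := by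
  rw [walkMatrix_apply_of_ne L hd, if_pos h]
  rintro rfl
  exact h.1 (G.loopless _)

lemma walkMatrix_flip (x y : V × Bool) :
    walkMatrix L d (flip x) (flip y) = walkMatrix L d x y := by
  simp only [walkMatrix, walkStep_flip]
  congr! 2 with i
  exact ⟨fun h => by rw [← flip_flip (walkStep (L.oracle d) i x), h, flip_flip], fun h => by rw [h]⟩

/-- The transition matrix acts on functions by averaging over the random choices. -/
lemma sum_walkMatrix_mul [Fintype V] (x : V × Bool) (g : V × Bool → ℝ) :
    ∑ y, walkMatrix L d x y * g y = 𝔼 i, g (walkStep (L.oracle d) i x) := by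
  simp only [walkMatrix, unifProb, Finset.expect_mul]
  rw [← Finset.expect_sum_comm]
  refine Finset.expect_congr rfl fun i _ => ?_
  simp [Finset.sum_ite_eq]

lemma isLazyReversible_walkMatrix [Fintype V] (hd : G.DegreeLE d) (hd0 : 0 < d) :
    IsLazyReversible (walkMatrix L d) where
  symm := by
    ext x y
    rw [Matrix.transpose_apply]
    by_cases hxy : x = y
    · rw [hxy]
    rw [walkMatrix_apply_of_ne L hd hxy, walkMatrix_apply_of_ne L hd (Ne.symm hxy)]
    exact if_congr ⟨CoverAdj.symm, CoverAdj.symm⟩ rfl rfl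
  nonneg x y := unifProb_nonneg _
  row_sum x := by
    have : Nonempty (Fin d) := ⟨⟨0, hd0⟩⟩
    have := sum_walkMatrix_mul L (d := d) x fun _ => 1
    simpa [Fintype.expect_const] using this
  lazy x := by
    have hd0' : (0 : ℝ) < d := by exact_mod_cast hd0
    have h : unifProb (fun i : Bool × Fin d => i.1 = false) = 1 / 2 := by
      rw [unifProb_eq_card_div]
      have : (univ.filter fun i : Bool × Fin d => i.1 = false) = {false} ×ˢ univ := by
        ext ⟨b, i⟩
        simp
      rw [this, Finset.card_product]
      simp
      field_simp
    rw [← h]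
    refine unifProb_mono fun i hi => ?_
    simp [walkStep, hi]

section Flip

variable [Fintype V] {p : Matrix (V × Bool) (V × Bool) ℝ}

/-- The part of the double cover over a set of vertices. -/
def cover (U : Finset V) : Finset (V × Bool) := U ×ˢ univ

omit [Fintype V] in
lemma mem_cover {U : Finset V} {x : V × Bool} : x ∈ cover U ↔ x.1 ∈ U := by simp [cover]

/-- The exchange of the sheets as a permutation. -/
def flipEquiv : V × Bool ≃ V × Bool := ⟨flip, flip, flip_flip, flip_flip⟩

lemma excursion_flip (hp : ∀ x y, p (flip x) (flip y) = p x y) (U : Finset V) (n : ℕ)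
    (x y : V × Bool) :
    excursion p (cover U) n (flip x) (flip y) = excursion p (cover U) n x y := by
  induction n generalizing x with
  | zero => simp [excursion]
  | succ n ih =>
    rw [excursion_succ_apply, excursion_succ_apply, hp]
    congr 1
    refine (Fintype.sum_equiv flipEquiv _ _ fun z => ?_).symm
    change _ = p (flip x) (flip z) * (if flip z ∈ cover U then 0 else
      excursion p (cover U) n (flip z) (flip y))
    rw [hp, ih]
    simp only [mem_cover]
    rfl

lemma traceChain_pow_flip (hp : ∀ x y, p (flip x) (flip y) = p x y) (U : Finset V) (l k : ℕ)
    (x y : V × Bool) :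
    (traceChain p (cover U) l ^ k) (flip x) (flip y) = (traceChain p (cover U) l ^ k) x y := by
  induction k generalizing x with
  | zero =>
    simp only [pow_zero, Matrix.one_apply]
    exact if_congr (flipEquiv.injective.eq_iff (a := x) (b := y)) rfl rfl
  | succ k ih =>
    rw [pow_succ', Matrix.mul_apply, Matrix.mul_apply]
    refine (Fintype.sum_equiv flipEquiv _ _ fun z => ?_).symm
    change _ = traceChain p (cover U) l (flip x) (flip z) *
      (traceChain p (cover U) l ^ k) (flip z) (flip y)
    rw [ih]
    simp only [traceChain_apply, excursion_flip hp, mem_cover]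
    rfl

end Flip

end SignedGraph

/-! ### A Cheeger inequality for signed graphs -/

section LayerCake

open Finset MeasureTheory

/-- If every level `θ > 0` lies in at least `c` times as many of the intervals `(lo i, hi i]` as of
the intervals `(0, a k]`, then the total lengths compare in the same way. -/
lemma mul_sum_le_sum_sub_of_level {ι κ : Type*} [Fintype ι] [Fintype κ] (lo hi : ι → ℝ)
    (a : κ → ℝ) (hlo : ∀ i, lo i ≤ hi i) (ha : ∀ k, 0 ≤ a k) (c : ℝ)
    (h : ∀ θ : ℝ, 0 < θ → c * #{k | θ ≤ a k} ≤ #{i | lo i < θ ∧ θ ≤ hi i}) :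
    c * ∑ k, a k ≤ ∑ i, (hi i - lo i) := by
  have hint (u v : ℝ) : Integrable (Set.indicator (Set.Ioc u v) fun _ => (1 : ℝ)) :=
    (integrable_indicator_iff measurableSet_Ioc).2 (by simp)
  have hval (u v : ℝ) (huv : u ≤ v) :
      ∫ θ, Set.indicator (Set.Ioc u v) (fun _ => (1 : ℝ)) θ = v - u := by
    rw [integral_indicator measurableSet_Ioc]
    simp [huv]
  have h1 : ∫ θ, c * ∑ k, Set.indicator (Set.Ioc 0 (a k)) (fun _ => (1 : ℝ)) θ ≤
      ∫ θ, ∑ i, Set.indicator (Set.Ioc (lo i) (hi i)) (fun _ => (1 : ℝ)) θ := by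
    refine integral_mono ((integrable_finsetSum _ fun k _ => hint _ _).const_mul c)
      (integrable_finsetSum _ fun i _ => hint _ _) fun θ => ?_
    by_cases hθ : 0 < θ
    · have := h θ hθ
      simp only [Finset.card_filter] at this
      push_cast at this
      simpa [Set.indicator_apply, hθ] using this
    · have hz : ∑ k, Set.indicator (Set.Ioc 0 (a k)) (fun _ => (1 : ℝ)) θ = 0 :=
        Finset.sum_eq_zero fun k _ => by simp [hθ]
      simp only [hz, mul_zero]
      exact Finset.sum_nonneg fun i _ => Set.indicator_nonneg (fun _ _ => zero_le_one) θ
  rw [integral_const_mul, integral_finsetSum _ fun k _ => hint _ _,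
    integral_finsetSum _ fun i _ => hint _ _] at h1
  simpa [hval, ha, hlo] using h1

end LayerCake

namespace SignedGraph

open Finset Classical
open scoped BigOperators

variable {V : Type} {G : SignedGraph V}

/-- The pair `(u, v)` is an edge that contradicts the clustering `c`. -/
def Violates (G : SignedGraph V) (c : V → Bool) (u v : V) : Prop :=
  (G.label s(u, v) = 1 ∧ c u ≠ c v) ∨ (G.label s(u, v) = -1 ∧ c u = c v)

lemma Violates.label_ne_zero {c : V → Bool} {u v : V} (h : G.Violates c u v) :
    G.label s(u, v) ≠ 0 := by
  rcases h with h | h <;> rw [h.1] <;> decide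

/-- The graph without the edges that violate a clustering. -/
noncomputable def deleteViolations (G : SignedGraph V) (c : V → Bool) : SignedGraph V where
  label e := if ∃ u v, e = s(u, v) ∧ G.Violates c u v then 0 else G.label e
  loopless v := by simp [G.loopless v]

lemma balanced_deleteViolations (c : V → Bool) : (G.deleteViolations c).Balanced := by
  refine ⟨c, fun u v => ⟨fun h => ?_, fun h => ?_⟩⟩ <;> simp only [deleteViolations] at h <;>
    split_ifs at h with h1
  · by_contra h2
    exact h1 ⟨u, v, rfl, Or.inl ⟨h, h2⟩⟩
  · intro h2
    exact h1 ⟨u, v, rfl, Or.inr ⟨h, h2⟩⟩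

lemma card_neighbors_le [Fintype V] {d : ℕ} (hd : G.DegreeLE d) (u : V) :
    #{v | G.label s(u, v) ≠ 0} ≤ d := by
  refine le_trans (le_of_eq ?_) (hd u)
  rw [degree, ← Set.ncard_coe_finset]
  congr 1
  ext w
  simp

lemma sum_edges_le [Fintype V] {d : ℕ} (hd : G.DegreeLE d) (g : V → ℝ) (hg : ∀ v, 0 ≤ g v) :
    ∑ e : V × V with G.label s(e.1, e.2) ≠ 0, g e.1 ≤ d * ∑ v, g v := by
  rw [Finset.sum_filter, ← Finset.univ_product_univ, Finset.sum_product, Finset.mul_sum]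
  refine Finset.sum_le_sum fun u _ => ?_
  simp only
  rw [← Finset.sum_filter, Finset.sum_const, nsmul_eq_mul]
  exact mul_le_mul_of_nonneg_right (by exact_mod_cast card_neighbors_le hd u) (hg u)

lemma sum_edges_swap [Fintype V] (g : V × V → ℝ) :
    ∑ e : V × V with G.label s(e.1, e.2) ≠ 0, g e.swap =
      ∑ e : V × V with G.label s(e.1, e.2) ≠ 0, g e := by
  refine Finset.sum_nbij' Prod.swap Prod.swap ?_ ?_ ?_ ?_ ?_
  · intro e he
    simp only [Finset.mem_filter, Finset.mem_univ, true_and, Prod.fst_swap, Prod.snd_swap] at he ⊢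
    rwa [Sym2.eq_swap]
  · intro e he
    simp only [Finset.mem_filter, Finset.mem_univ, true_and, Prod.fst_swap, Prod.snd_swap] at he ⊢
    rwa [Sym2.eq_swap]
  all_goals simp

/-- The Cheeger inequality for the signed Laplacian, restricted to a set `U` of vertices. If the
Rayleigh quotient of `D` is small, then the superlevel sets of `D ^ 2`, clustered by the sign of `D`,
have on average few boundary edges within `U` and few violating edges. -/
lemma exists_cluster_of_rayleigh_le [Fintype V] {d : ℕ} (hd : G.DegreeLE d) (hd0 : 0 < d)
    (U : Finset V) (D : V → ℝ) (hDU : ∀ v ∉ U, D v = 0) (hD : 0 < ∑ v, D v ^ 2) {η : ℝ} (hη : 0 < η)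
    (hR : ∑ e : V × V with G.label s(e.1, e.2) ≠ 0 ∧ e.1 ∈ U ∧ e.2 ∈ U,
      (D e.1 - (if G.label s(e.1, e.2) = -1 then -1 else 1) * D e.2) ^ 2 ≤
        4 * d * η * ∑ v, D v ^ 2) :
    ∃ S ⊆ U, S.Nonempty ∧ ∃ c : V → Bool,
      (#{e : V × V | (G.label s(e.1, e.2) ≠ 0 ∧ e.1 ∈ U ∧ e.2 ∈ U) ∧ (e.1 ∈ S ∨ e.2 ∈ S) ∧
        (e.1 ∈ S → e.2 ∈ S → G.Violates c e.1 e.2)} : ℝ) ≤ 5 * d * √η * #S := by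
  set A := ∑ v, D v ^ 2 with hA
  set c : V → Bool := fun v => decide (0 < D v) with hc
  have hd0' : (0 : ℝ) < d := by exact_mod_cast hd0
  by_contra! hcon
  let E : Type := {e : V × V // G.label s(e.1, e.2) ≠ 0 ∧ e.1 ∈ U ∧ e.2 ∈ U}
  let lo : E → ℝ := fun e =>
    if G.Violates c e.1.1 e.1.2 then 0 else min (D e.1.1 ^ 2) (D e.1.2 ^ 2)
  let hi : E → ℝ := fun e => max (D e.1.1 ^ 2) (D e.1.2 ^ 2)
  have hlayer : 5 * d * √η * ∑ v, D v ^ 2 ≤ ∑ e : E, (hi e - lo e) := by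
    refine mul_sum_le_sum_sub_of_level lo hi (fun v => D v ^ 2) ?_ (fun v => sq_nonneg _) _ ?_
    · intro e
      simp only [lo, hi]
      split_ifs
      exacts [le_max_of_le_left (sq_nonneg _), min_le_max]
    · intro θ hθ
      set S : Finset V := univ.filter fun v => θ ≤ D v ^ 2 with hS
      have hmem : ∀ v, v ∈ S ↔ θ ≤ D v ^ 2 := fun v => by simp [hS]
      rcases S.eq_empty_or_nonempty with h0 | h0
      · rw [h0]
        simp
      have hSU : S ⊆ U := fun v hv => by
        by_contra hvU
        rw [hmem, hDU v hvU] at hv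
        linarith [hv]
      refine (hcon S hSU h0 c).le.trans ?_
      rw [Nat.cast_le]
      refine Finset.card_le_card_of_surjOn (fun e : E => e.1) ?_
      intro e he
      simp only [Finset.coe_filter, Finset.mem_univ, true_and, Set.mem_ofPred_eq] at he
      obtain ⟨hE, h1, h2⟩ := he
      refine ⟨⟨e, hE⟩, ?_, rfl⟩
      simp only [Finset.coe_filter, Finset.mem_univ, true_and, Set.mem_ofPred_eq, lo, hi]
      simp only [hmem] at h1 h2
      refine ⟨?_, le_max_iff.2 h1⟩
      split_ifs with hv
      · exact hθ
      · rw [min_lt_iff]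
        by_contra! h3
        exact hv (h2 h3.1 h3.2)
  have hpt : ∀ e : E, hi e - lo e ≤
      |D e.1.1 - (if G.label s(e.1.1, e.1.2) = -1 then -1 else 1) * D e.1.2| *
        (|D e.1.1| + |D e.1.2|) := by
    rintro ⟨⟨u, v⟩, hE, -⟩
    simp only [lo, hi]
    simp only at hE
    have habs : ∀ x y : ℝ, max (x ^ 2) (y ^ 2) ≤ (|x| + |y|) * (|x| + |y|) := fun x y => by
      rw [← sq_abs x, ← sq_abs y]
      refine max_le ?_ ?_ <;> nlinarith [abs_nonneg x, abs_nonneg y]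
    have hsub : ∀ x y : ℝ, max (x ^ 2) (y ^ 2) - min (x ^ 2) (y ^ 2) =
        |x - y| * |x + y| := fun x y => by
      rw [max_sub_min_eq_abs, ← abs_mul, abs_sub_comm]
      congr 1
      ring
    split_ifs with h1 h2 h2
    · rcases h1 with h1 | h1
      · rw [h2] at h1
        exact absurd h1.1 (by decide)
      · have : |D u - -1 * D v| = |D u| + |D v| := by
          rw [neg_one_mul, sub_neg_eq_add, abs_add_eq_add_abs_iff]
          have h3 := h1.2
          simp only [hc, decide_eq_decide] at h3
          by_cases hu : 0 < D u
          · exact Or.inl ⟨hu.le, (h3.1 hu).le⟩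
          · exact Or.inr ⟨not_lt.1 hu, not_lt.1 fun h => hu (h3.2 h)⟩
        rw [this, sub_zero]
        exact habs _ _
    · rcases h1 with h1 | h1
      · have : |D u - 1 * D v| = |D u| + |D v| := by
          have h3 := h1.2
          rw [one_mul, sub_eq_add_neg, ← abs_neg (D v), abs_add_eq_add_abs_iff]
          simp only [hc, ne_eq, decide_eq_decide] at h3
          by_cases hu : 0 < D u
          · exact Or.inl ⟨hu.le, by
              rw [Left.nonneg_neg_iff]
              exact not_lt.1 fun h => h3 ⟨fun _ => h, fun _ => hu⟩⟩
          · refine Or.inr ⟨not_lt.1 hu, ?_⟩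
            rw [Left.neg_nonpos_iff]
            by_contra h
            exact h3 ⟨fun h' => absurd h' hu, fun h' => absurd h'.le h⟩
        rw [this, sub_zero]
        exact habs _ _
      · exact absurd h1.1 h2
    · rw [hsub, neg_one_mul, sub_neg_eq_add, mul_comm]
      refine mul_le_mul_of_nonneg_left ?_ (abs_nonneg _)
      rw [sub_eq_add_neg, ← abs_neg (D v)]
      exact abs_add_le _ _
    · rw [hsub, one_mul]
      exact mul_le_mul_of_nonneg_left (abs_add_le _ _) (abs_nonneg _)
  have hsub : ∀ f : V × V → ℝ, ∑ e : E, f e.1 =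
      ∑ e : V × V with G.label s(e.1, e.2) ≠ 0 ∧ e.1 ∈ U ∧ e.2 ∈ U, f e := fun f =>
    (Finset.sum_subtype _ (by simp) f).symm
  have h1 : ∑ e : E, (D e.1.1 - (if G.label s(e.1.1, e.1.2) = -1 then -1 else 1) * D e.1.2) ^ 2 ≤
      4 * d * η * A := by
    rw [hsub fun e => (D e.1 - (if G.label s(e.1, e.2) = -1 then -1 else 1) * D e.2) ^ 2]
    exact hR
  have h2 : ∑ e : E, (|D e.1.1| + |D e.1.2|) ^ 2 ≤ 4 * d * A := by
    rw [hsub fun e => (|D e.1| + |D e.2|) ^ 2]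
    have h3 : ∑ e : V × V with G.label s(e.1, e.2) ≠ 0 ∧ e.1 ∈ U ∧ e.2 ∈ U,
        (|D e.1| + |D e.2|) ^ 2 ≤ ∑ e : V × V with G.label s(e.1, e.2) ≠ 0,
          (2 * D e.1 ^ 2 + 2 * D e.2 ^ 2) := by
      refine (Finset.sum_le_sum fun e _ => ?_).trans (Finset.sum_le_sum_of_subset_of_nonneg
        (fun e he => ?_) fun e _ _ => by positivity)
      · rw [← sq_abs (D e.1), ← sq_abs (D e.2)]
        nlinarith [sq_nonneg (|D e.1| - |D e.2|)]
      · rw [Finset.mem_filter] at he ⊢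
        exact ⟨he.1, he.2.1⟩
    have h4 := sum_edges_le hd (fun v => 2 * D v ^ 2) fun v => by positivity
    have h5 := sum_edges_swap (G := G) fun e => 2 * D e.1 ^ 2
    simp only [Prod.fst_swap] at h5
    rw [Finset.sum_add_distrib, h5] at h3
    have h6 : ∑ v, 2 * D v ^ 2 = 2 * A := by rw [hA, Finset.mul_sum]
    rw [h6] at h4
    linarith
  have hcs : (∑ e : E, (hi e - lo e)) ^ 2 ≤ (4 * d * η * A) * (4 * d * A) := by
    have h3 : 0 ≤ ∑ e : E, (hi e - lo e) := le_trans (by positivity) hlayer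
    have h4 := pow_le_pow_left₀ h3 (Finset.sum_le_sum fun e _ => hpt e) 2
    refine h4.trans ((Finset.sum_mul_sq_le_sq_mul_sq _ _ _).trans ?_)
    simp only [sq_abs]
    exact mul_le_mul h1 h2 (Finset.sum_nonneg fun e _ => sq_nonneg _) (by positivity)
  have hlow := pow_le_pow_left₀ (by positivity) hlayer 2
  rw [← hA] at hlow
  have hsq : (5 * d * √η * A) ^ 2 = 25 * (d ^ 2 * η * A ^ 2) := by
    have := Real.sq_sqrt hη.le
    calc (5 * d * √η * A) ^ 2 = 25 * (d ^ 2 * √η ^ 2 * A ^ 2) := by ring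
      _ = _ := by rw [this]
  have hpos : 0 < (d : ℝ) ^ 2 * η * A ^ 2 := by positivity
  nlinarith

end SignedGraph

/-! ### Clusters from non-colliding walks, and their greedy removal -/

namespace SignedGraph

open Finset Classical
open scoped BigOperators

variable {V : Type} [Fintype V] {G : SignedGraph V} (L : G.AdjacencyList) {d : ℕ}

/-- The Dirichlet form of a function on the double cover that changes sign under the exchange of the
sheets bounds the signed Dirichlet form of its restriction to one sheet. -/
lemma sum_signed_sq_le_dirichlet (hd : G.DegreeLE d) (hd0 : 0 < d) (U : Finset V)
    (F : V × Bool → ℝ) (hF : ∀ x, F (flip x) = -F x) :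
    ∑ e : V × V with G.label s(e.1, e.2) ≠ 0 ∧ e.1 ∈ U ∧ e.2 ∈ U,
      (F (e.1, false) - (if G.label s(e.1, e.2) = -1 then -1 else 1) * F (e.2, false)) ^ 2 ≤
    d * ∑ x ∈ cover U, ∑ y ∈ cover U, walkMatrix L d x y * (F x - F y) ^ 2 := by
  have hd0' : (0 : ℝ) < d := by exact_mod_cast hd0
  have hF' : ∀ v, F (v, true) = -F (v, false) := fun v => hF (v, false)
  have hexp : ∑ x ∈ cover U, ∑ y ∈ cover U, walkMatrix L d x y * (F x - F y) ^ 2 =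
      ∑ u ∈ U, ∑ v ∈ U, ∑ b : Bool, ∑ b' : Bool,
        walkMatrix L d (u, b) (v, b') * (F (u, b) - F (v, b')) ^ 2 := by
    simp only [cover, Finset.sum_product]
    refine Finset.sum_congr rfl fun u _ => ?_
    rw [Finset.sum_comm]
  rw [hexp, Finset.mul_sum]
  have hlhs : ∑ e : V × V with G.label s(e.1, e.2) ≠ 0 ∧ e.1 ∈ U ∧ e.2 ∈ U,
      (F (e.1, false) - (if G.label s(e.1, e.2) = -1 then -1 else 1) * F (e.2, false)) ^ 2 =
      ∑ u ∈ U, ∑ v ∈ U, if G.label s(u, v) ≠ 0 then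
        (F (u, false) - (if G.label s(u, v) = -1 then -1 else 1) * F (v, false)) ^ 2 else 0 := by
    rw [← Finset.sum_product', ← Finset.sum_filter]
    refine Finset.sum_congr ?_ fun _ _ => rfl
    ext e
    simp only [Finset.mem_filter, Finset.mem_univ, true_and, Finset.mem_product]
    tauto
  rw [hlhs]
  refine Finset.sum_le_sum fun u _ => ?_
  rw [Finset.mul_sum]
  refine Finset.sum_le_sum fun v _ => ?_
  have hnn : ∀ b b', 0 ≤ walkMatrix L d (u, b) (v, b') * (F (u, b) - F (v, b')) ^ 2 :=
    fun b b' => mul_nonneg (unifProb_nonneg _) (sq_nonneg _)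
  have hnn' : 0 ≤ ∑ b : Bool, ∑ b' : Bool,
      walkMatrix L d (u, b) (v, b') * (F (u, b) - F (v, b')) ^ 2 :=
    Finset.sum_nonneg fun b _ => Finset.sum_nonneg fun b' _ => hnn b b'
  split_ifs with h1 h2
  · have e1 : ∀ b, walkMatrix L d (u, b) (v, !b) = 1 / (2 * d) := fun b =>
      walkMatrix_of_coverAdj L hd ⟨h1, by simp [h2]⟩
    simp only [Fintype.sum_bool, hF']
    have h3 := hnn true true
    have h4 := hnn false false
    simp only [hF'] at h3 h4
    rw [show walkMatrix L d (u, true) (v, false) = 1 / (2 * d) from e1 true,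
      show walkMatrix L d (u, false) (v, true) = 1 / (2 * d) from e1 false]
    have h5 : (F (u, false) - -1 * F (v, false)) ^ 2 =
        d * (1 / (2 * d) * (-F (u, false) - F (v, false)) ^ 2 +
          1 / (2 * d) * (F (u, false) - -F (v, false)) ^ 2) := by
      field_simp
      ring
    rw [h5]
    refine mul_le_mul_of_nonneg_left ?_ hd0'.le
    linarith
  · have e1 : ∀ b, walkMatrix L d (u, b) (v, b) = 1 / (2 * d) := fun b =>
      walkMatrix_of_coverAdj L hd ⟨h1, by simp [h2]⟩
    simp only [Fintype.sum_bool, hF']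
    have h3 := hnn true false
    have h4 := hnn false true
    simp only [hF'] at h3 h4
    rw [e1 true, e1 false]
    have h5 : (F (u, false) - 1 * F (v, false)) ^ 2 =
        d * (1 / (2 * d) * (-F (u, false) - -F (v, false)) ^ 2 +
          1 / (2 * d) * (F (u, false) - F (v, false)) ^ 2) := by
      field_simp
      ring
    rw [h5]
    refine mul_le_mul_of_nonneg_left ?_ hd0'.le
    linarith
  · positivity

/-- If the trace chain of the walk on the part over `U`, started over `s ∈ U`, loses little mass in
`k` steps, and if the two sheets of its distribution then hardly overlap, then `U` contains a set
that can be clustered with few violating and few outgoing edges. -/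
lemma exists_cluster_of_small_overlap (hd : G.DegreeLE d) (hd0 : 0 < d) (U : Finset V) {s : V}
    (hs : s ∈ U) {l : ℕ} (hl : 0 < l) (k : ℕ) {η : ℝ} (hη : 0 < η) (hη1 : η ≤ 1)
    (hk : (1 - η) ^ k * (4 * Fintype.card V) < 1)
    (hloss : 3 / 4 ≤ ∑ y, (traceChain (walkMatrix L d) (cover U) l ^ k) (s, false) y)
    (hoverlap : ∑ v, min ((traceChain (walkMatrix L d) (cover U) l ^ k) (s, false) (v, false))
      ((traceChain (walkMatrix L d) (cover U) l ^ k) (s, false) (v, true)) ≤ 1 / 8) :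
    ∃ S ⊆ U, S.Nonempty ∧ ∃ c : V → Bool,
      (#{e : V × V | (G.label s(e.1, e.2) ≠ 0 ∧ e.1 ∈ U ∧ e.2 ∈ U) ∧ (e.1 ∈ S ∨ e.2 ∈ S) ∧
        (e.1 ∈ S → e.2 ∈ S → G.Violates c e.1 e.2)} : ℝ) ≤ 5 * d * √η * #S := by
  set B := traceChain (walkMatrix L d) (cover U) l with hB
  have hp := isLazyReversible_walkMatrix L hd hd0
  set F₀ : V × Bool → ℝ := Pi.single (s, false) 1 - Pi.single (s, true) 1 with hF₀
  have hFj : ∀ j y, ((B ^ j).mulVec F₀) y = (B ^ j) (s, false) y - (B ^ j) (s, false) (flip y) := by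
    intro j y
    rw [hF₀, Matrix.mulVec_sub, Matrix.mulVec_single_one, Matrix.mulVec_single_one, Pi.sub_apply,
      Matrix.col_apply, Matrix.col_apply]
    congr 1
    · exact traceChain_pow_symm hp l j _ _
    · rw [hB, traceChain_pow_symm hp l j (s, false), ← traceChain_pow_flip (walkMatrix_flip L)]
      rfl
  have hanti : ∀ j y, ((B ^ j).mulVec F₀) (flip y) = -((B ^ j).mulVec F₀) y := by
    intro j y
    rw [hFj, hFj, flip_flip]
    ring
  have hcard : (Fintype.card (V × Bool) : ℝ) = 2 * Fintype.card V := by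
    rw [Fintype.card_prod, Fintype.card_bool]
    push_cast
    ring
  have hV : (0 : ℝ) < Fintype.card V := by exact_mod_cast Fintype.card_pos_iff.2 ⟨s⟩
  -- the signed distribution after `k` steps still has a large `ℓ¹` norm, hence a large `ℓ²` norm
  have hl1 : 1 ≤ ∑ y, |((B ^ k).mulVec F₀) y| := by
    have h1 : ∀ y, (B ^ k) (s, false) y + (B ^ k) (s, false) (flip y) -
        2 * min ((B ^ k) (s, false) y) ((B ^ k) (s, false) (flip y)) ≤ |((B ^ k).mulVec F₀) y| := by
      intro y
      rw [hFj, ← max_sub_min_eq_abs', ← max_add_min ((B ^ k) (s, false) y)]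
      linarith
    have h2 := Finset.sum_le_sum fun y (_ : y ∈ univ) => h1 y
    rw [Finset.sum_sub_distrib, Finset.sum_add_distrib, ← Finset.mul_sum] at h2
    have h3 : ∑ y, (B ^ k) (s, false) (flip y) = ∑ y, (B ^ k) (s, false) y :=
      Fintype.sum_equiv flipEquiv _ _ fun _ => rfl
    have h4 : ∑ y, min ((B ^ k) (s, false) y) ((B ^ k) (s, false) (flip y)) =
        2 * ∑ v, min ((B ^ k) (s, false) (v, false)) ((B ^ k) (s, false) (v, true)) := by
      rw [Fintype.sum_prod_type, Finset.mul_sum]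
      refine Finset.sum_congr rfl fun v _ => ?_
      rw [Fintype.sum_bool]
      simp only [flip, Bool.not_true, Bool.not_false]
      rw [min_comm]
      ring
    rw [h3, h4] at h2
    linarith
  have hl2 : (1 - η) ^ k * ∑ x, F₀ x ^ 2 < ∑ x, ((B ^ k).mulVec F₀) x ^ 2 := by
    have h0 : ∑ x, F₀ x ^ 2 = 2 := by
      have h : ∀ x, F₀ x ^ 2 = (Pi.single (s, false) 1 : V × Bool → ℝ) x +
          (Pi.single (s, true) 1 : V × Bool → ℝ) x := fun x => by
        simp only [hF₀, Pi.sub_apply, Pi.single_apply]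
        split_ifs with h1 h2
        · rw [h1] at h2
          simp at h2
        all_goals norm_num
      simp only [h, Finset.sum_add_distrib]
      simp
      norm_num
    have h1 := Finset.sum_mul_sq_le_sq_mul_sq univ (fun _ : V × Bool => (1 : ℝ))
      (fun y => |((B ^ k).mulVec F₀) y|)
    simp only [one_mul, one_pow, sq_abs, Finset.sum_const, Finset.card_univ, nsmul_eq_mul,
      mul_one] at h1
    rw [hcard] at h1
    have h2 : 1 ≤ (∑ y, |((B ^ k).mulVec F₀) y|) ^ 2 := one_le_pow₀ hl1
    rw [h0]
    nlinarith
  obtain ⟨j, hj0, hj⟩ := exists_dirichlet_le hp hl F₀ hη1 k hl2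
  rw [← hB] at hj0 hj
  set F := (B ^ j).mulVec F₀ with hF
  have hnorm : ∑ x, F x ^ 2 = 2 * ∑ v, F (v, false) ^ 2 := by
    rw [Fintype.sum_prod_type, Finset.mul_sum]
    refine Finset.sum_congr rfl fun v _ => ?_
    rw [Fintype.sum_bool, show F (v, true) = -F (v, false) from hanti j (v, false)]
    ring
  refine exists_cluster_of_rayleigh_le hd hd0 U (fun v => F (v, false)) ?_ ?_ hη ?_
  · intro v hv
    have h1 : ∀ b, (B ^ j) (s, false) (v, b) = 0 := fun b =>
      traceChain_pow_apply_eq_zero l (mem_cover.2 hs) (fun h => hv (mem_cover.1 h))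
    change F (v, false) = 0
    rw [hF, hFj, flip, h1, h1, sub_zero]
  · rw [hnorm] at hj0
    linarith
  · refine (sum_signed_sq_le_dirichlet L hd hd0 U F (hanti j)).trans ?_
    rw [hnorm] at hj
    have := mul_le_mul_of_nonneg_left hj (Nat.cast_nonneg (α := ℝ) d)
    linarith

omit [Fintype V] in
lemma violates_congr {c c' : V → Bool} {u v : V} (hu : c u = c' u) (hv : c v = c' v) :
    G.Violates c u v ↔ G.Violates c' u v := by
  rw [Violates, Violates, hu, hv]

/-- If every large set of vertices contains a cluster with few violating and outgoing edges, then
removing clusters greedily yields a clustering of all vertices with few violating edges. -/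
lemma exists_clustering_of_greedy (hd : G.DegreeLE d) {φ τ : ℝ} (hτ : 0 ≤ τ) (hφ : 0 ≤ φ)
    (h : ∀ U : Finset V, τ ≤ #U → U.Nonempty → ∃ S ⊆ U, S.Nonempty ∧ ∃ c : V → Bool,
      (#{e : V × V | (G.label s(e.1, e.2) ≠ 0 ∧ e.1 ∈ U ∧ e.2 ∈ U) ∧ (e.1 ∈ S ∨ e.2 ∈ S) ∧
        (e.1 ∈ S → e.2 ∈ S → G.Violates c e.1 e.2)} : ℝ) ≤ φ * #S) (U : Finset V) :
    ∃ c : V → Bool, (#{e : V × V | e.1 ∈ U ∧ e.2 ∈ U ∧ G.Violates c e.1 e.2} : ℝ) ≤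
      φ * #U + d * τ := by
  induction hn : #U using Nat.strong_induction_on generalizing U with
  | _ n ih =>
    subst hn
    rcases U.eq_empty_or_nonempty with h0 | h0
    · refine ⟨fun _ => true, ?_⟩
      subst h0
      simp only [Finset.notMem_empty, false_and, Finset.filter_false, Finset.card_empty,
        Nat.cast_zero, mul_zero, zero_add]
      positivity
    by_cases hU : τ ≤ #U
    · obtain ⟨S, hSU, hS, c, hc⟩ := h U hU h0
      obtain ⟨c', hc'⟩ := ih #(U \ S) (Finset.card_lt_card (by
        rw [Finset.ssubset_iff_subset_ne]
        refine ⟨Finset.sdiff_subset, fun he => ?_⟩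
        obtain ⟨v, hv⟩ := hS
        have h1 := hSU hv
        rw [← he, Finset.mem_sdiff] at h1
        exact h1.2 hv)) (U \ S) rfl
      refine ⟨fun v => if v ∈ S then c v else c' v, ?_⟩
      have hsub : (univ.filter fun e : V × V => e.1 ∈ U ∧ e.2 ∈ U ∧
          G.Violates (fun v => if v ∈ S then c v else c' v) e.1 e.2) ⊆
          (univ.filter fun e : V × V => (G.label s(e.1, e.2) ≠ 0 ∧ e.1 ∈ U ∧ e.2 ∈ U) ∧
            (e.1 ∈ S ∨ e.2 ∈ S) ∧ (e.1 ∈ S → e.2 ∈ S → G.Violates c e.1 e.2)) ∪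
          (univ.filter fun e : V × V => e.1 ∈ U \ S ∧ e.2 ∈ U \ S ∧ G.Violates c' e.1 e.2) := by
        rintro ⟨u, v⟩ he
        simp only [Finset.mem_filter, Finset.mem_univ, true_and, Finset.mem_union,
          Finset.mem_sdiff] at he ⊢
        obtain ⟨hu, hv, he⟩ := he
        by_cases hSS : u ∈ S ∨ v ∈ S
        · refine Or.inl ⟨⟨he.label_ne_zero, hu, hv⟩, hSS, fun h1 h2 => ?_⟩
          exact (violates_congr (by simp [h1]) (by simp [h2])).1 he
        · push Not at hSS
          refine Or.inr ⟨⟨hu, hSS.1⟩, ⟨hv, hSS.2⟩, ?_⟩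
          exact (violates_congr (by simp [hSS.1]) (by simp [hSS.2])).1 he
      have h1 := (Finset.card_le_card hsub).trans (Finset.card_union_le _ _)
      have h2 : (#S : ℝ) + #(U \ S) = #U := by
        exact_mod_cast (add_comm _ _).trans (Finset.card_sdiff_add_card_eq_card hSU)
      have h3 := (Nat.cast_le (α := ℝ)).2 h1
      push_cast at h3
      have h4 : φ * #U = φ * #S + φ * #(U \ S) := by rw [← h2]; ring
      linarith
    · refine ⟨fun _ => true, ?_⟩
      have hle : #(univ.filter fun e : V × V => e.1 ∈ U ∧ e.2 ∈ U ∧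
          G.Violates (fun _ => true) e.1 e.2) ≤ d * #U := by
        refine (Finset.card_le_card (t := U.biUnion fun u =>
          (univ.filter fun v => G.label s(u, v) ≠ 0).image fun v => (u, v)) ?_).trans ?_
        · rintro ⟨u, v⟩ he
          simp only [Finset.mem_filter, Finset.mem_univ, true_and] at he
          simp only [Finset.mem_biUnion, Finset.mem_image, Finset.mem_filter, Finset.mem_univ,
            true_and]
          exact ⟨u, he.1, v, he.2.2.label_ne_zero, rfl⟩
        · rw [mul_comm]
          exact Finset.card_biUnion_le_card_mul _ _ _ fun u _ =>
            Finset.card_image_le.trans (card_neighbors_le hd u)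
      have h1 := (Nat.cast_le (α := ℝ)).2 hle
      push_cast at h1
      have h2 : (d : ℝ) * #U ≤ d * τ :=
        mul_le_mul_of_nonneg_left (not_le.1 hU).le (Nat.cast_nonneg d)
      have h3 : 0 ≤ φ * #U := by positivity
      linarith

lemma modifications_deleteViolations_le (c : V → Bool) :
    G.modifications (G.deleteViolations c) ≤ #{e : V × V | G.Violates c e.1 e.2} := by
  rw [modifications, ← Set.ncard_coe_finset]
  refine (Set.ncard_le_ncard (t := (fun e : V × V => s(e.1, e.2)) ''
    (univ.filter fun e : V × V => G.Violates c e.1 e.2 : Finset (V × V))) ?_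
      (Set.toFinite _)).trans (Set.ncard_image_le (Set.toFinite _))
  intro e he
  simp only [deleteViolations, Set.mem_ofPred_eq] at he
  split_ifs at he with h
  · obtain ⟨u, v, rfl, h⟩ := h
    exact ⟨(u, v), by simpa using h, rfl⟩
  · exact absurd rfl he

end SignedGraph

/-! ### Trace chains as stopped walks -/

section StoppedRun

open Finset Classical
open scoped BigOperators

variable {I X : Type*} [DecidableEq X] (step : I → X → X)

/-- The states visited when the steps in a list are made one after the other. -/
def trajectory : List I → X → List X
  | [], x => [x]
  | i :: is, x => x :: trajectory is (step i x)

/-- The state at which the walk with the given steps makes its `k`-th visit to `U`, provided that the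
first visit takes at most `j` steps and each of the following ones at most `l`. -/
def stoppedRun (U : Finset X) (l : ℕ) : List I → ℕ → ℕ → X → Option X
  | _, 0, _, x => some x
  | [], _ + 1, _, _ => none
  | _ :: _, _ + 1, 0, _ => none
  | i :: is, k + 1, j + 1, x =>
    if step i x ∈ U then stoppedRun U l is k l (step i x)
    else stoppedRun U l is (k + 1) j (step i x)

omit [DecidableEq X] in
lemma mem_trajectory_self (is : List I) (x : X) : x ∈ trajectory step is x := by
  cases is <;> simp [trajectory]

lemma mem_trajectory_of_stoppedRun {U : Finset X} {l : ℕ} {is : List I} {k j : ℕ} {x y : X}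
    (h : stoppedRun step U l is k j x = some y) : y ∈ trajectory step is x := by
  induction is generalizing k j x with
  | nil =>
    rcases k with _ | k
    · simp only [stoppedRun, Option.some.injEq] at h
      rw [← h]
      exact mem_trajectory_self _ _ _
    · simp [stoppedRun] at h
  | cons i is ih =>
    rcases k with _ | k
    · simp only [stoppedRun, Option.some.injEq] at h
      rw [← h]
      exact mem_trajectory_self _ _ _
    · rcases j with _ | j
      · simp [stoppedRun] at h
      · rw [stoppedRun] at h
        rw [trajectory, List.mem_cons]
        split_ifs at h
        · exact Or.inr (ih h)
        · exact Or.inr (ih h)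

/-- The probability that `k` visits to `U` are made, the first within `j` steps and each of the
following ones within `l`, and that the last visit is at the given state. -/
noncomputable def visitProb [Fintype X] (p : Matrix X X ℝ) (U : Finset X) (l : ℕ) :
    ℕ → ℕ → X → X → ℝ
  | 0, _, x, y => if x = y then 1 else 0
  | k + 1, j, x, y => ∑ z ∈ U, excursion p U j x z * visitProb p U l k l z y

lemma visitProb_eq_traceChain_pow [Fintype X] (p : Matrix X X ℝ) (U : Finset X) (l k : ℕ) {x : X}
    (hx : x ∈ U) (y : X) : visitProb p U l k l x y = (traceChain p U l ^ k) x y := by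
  induction k generalizing x with
  | zero => simp [visitProb, Matrix.one_apply]
  | succ k ih =>
    rw [visitProb, pow_succ', Matrix.mul_apply, ← Finset.sum_subset (Finset.subset_univ U)]
    · refine Finset.sum_congr rfl fun z hz => ?_
      rw [ih hz, traceChain_apply, if_pos ⟨hx, hz⟩]
    · intro z _ hz
      rw [traceChain_apply, if_neg fun h => hz h.2, zero_mul]

lemma visitProb_succ_succ [Fintype X] (p : Matrix X X ℝ) (U : Finset X) (l k j : ℕ) (x y : X) :
    visitProb p U l (k + 1) (j + 1) x y = ∑ z, p x z *
      (if z ∈ U then visitProb p U l k l z y else visitProb p U l (k + 1) j z y) := by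
  rw [visitProb]
  simp only [excursion_succ_apply, add_mul, Finset.sum_add_distrib, Finset.sum_mul]
  rw [Finset.sum_comm (s := U), ← Finset.sum_add_sum_compl U fun z => p x z * _,
    ← Finset.sum_add_sum_compl U fun z => ∑ _ ∈ U, _, ← add_assoc]
  congr 1
  · rw [← Finset.sum_add_distrib]
    refine Finset.sum_congr rfl fun z hz => ?_
    simp [hz]
  · refine Finset.sum_congr rfl fun z hz => ?_
    rw [Finset.mem_compl] at hz
    simp only [if_neg hz, visitProb, Finset.mul_sum, mul_assoc]

variable {step}

/-- The final state of the stopped walk has the distribution computed by the excursion matrices, if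
the number `n` of available steps suffices. -/
lemma unifProb_stoppedRun [Fintype I] [Nonempty I] [Fintype X] {p : Matrix X X ℝ}
    (hp : ∀ x (g : X → ℝ), ∑ y, p x y * g y = 𝔼 i, g (step i x)) (U : Finset X) (l n k j : ℕ)
    (hn : (k - 1) * l + j ≤ n ∨ k = 0) (x y : X) :
    unifProb (fun ω : Fin n → I => stoppedRun step U l (List.ofFn ω) k j x = some y) =
      visitProb p U l k j x y := by
  induction n generalizing k j x with
  | zero =>
    rcases k with _ | k
    · simp [stoppedRun, visitProb, unifProb]
    · obtain rfl : j = 0 := by omega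
      simp [stoppedRun, visitProb, unifProb, excursion]
  | succ n ih =>
    rcases k with _ | k
    · simp only [stoppedRun, visitProb, unifProb, Option.some.injEq, Fintype.expect_const]
    rcases j with _ | j
    · simp [stoppedRun, visitProb, unifProb, excursion]
    rw [visitProb_succ_succ, hp, unifProb, expect_fin_cons]
    refine Finset.expect_congr rfl fun a _ => ?_
    simp only [List.ofFn_succ, Fin.cons_zero, Fin.cons_succ, stoppedRun]
    have hkl : k * l + j ≤ n := by
      rcases hn with hn | hn
      · simp only [add_tsub_cancel_right] at hn
        omega
      · omega
    by_cases ha : step a x ∈ U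
    · simp only [if_pos ha]
      rw [expect_ite_one]
      refine ih k l ?_ _
      rcases k with _ | k
      · exact Or.inr rfl
      · left
        rw [add_tsub_cancel_right, ← Nat.succ_mul]
        exact le_of_add_le_left hkl
    · simp only [if_neg ha]
      rw [expect_ite_one]
      refine ih (k + 1) j (Or.inl ?_) _
      rwa [add_tsub_cancel_right]

end StoppedRun

/-! ### Graphs far from balanced have many detecting vertices -/

namespace SignedGraph

open Finset Classical
open scoped BigOperators

variable {V : Type} [Fintype V] {G : SignedGraph V} (L : G.AdjacencyList) {d : ℕ}

/-- The random choices of one round of the tester after the choice of the starting vertex: two batches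
of `K` walks with `T` steps. -/
abbrev RoundSeed (d K T : ℕ) : Type :=
  (Fin K → Fin T → Bool × Fin d) × (Fin K → Fin T → Bool × Fin d)

/-- Some vertex is reached on the sheet of the start by a walk of the first batch and on the other
sheet by a walk of the second batch. -/
def Conflict {K T : ℕ} (O : V × Fin d → Option (V × SignType)) (s : V) (ω : RoundSeed d K T) :
    Prop :=
  ∃ i j v, (v, false) ∈ trajectory (walkStep O) (List.ofFn (ω.1 i)) (s, false) ∧
    (v, true) ∈ trajectory (walkStep O) (List.ofFn (ω.2 j)) (s, false)

/-- If the distribution of the walk stopped at its `k`-th visit to the part over `U` has overlapping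
sheets, then a round started in `s` finds a conflict with probability at least one half. -/
lemma half_le_unifProb_conflict (hd0 : 0 < d) (U : Finset V) {s : V}
    (hs : s ∈ U) (l k : ℕ) {n : ℕ} (hn : 0 < n) (hnV : Fintype.card V ≤ n ^ 2)
    (hd : G.DegreeLE d)
    (hoverlap : 1 / 8 ≤ ∑ v,
      min ((traceChain (walkMatrix L d) (cover U) l ^ k) (s, false) (v, false))
        ((traceChain (walkMatrix L d) (cover U) l ^ k) (s, false) (v, true))) :
    1 / 2 ≤ unifProb fun ω : RoundSeed d (128 * n) (k * l) => Conflict (L.oracle d) s ω := by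
  have : Nonempty (Fin d) := ⟨⟨0, hd0⟩⟩
  have hp := isLazyReversible_walkMatrix L hd hd0
  let final (a : Fin (k * l) → Bool × Fin d) : Option (V × Bool) :=
    stoppedRun (walkStep (L.oracle d)) (cover U) l (List.ofFn a) k l (s, false)
  let onSheet (b : Bool) (a : Fin (k * l) → Bool × Fin d) : Option V :=
    (final a).bind fun x => if x.2 = b then some x.1 else none
  have honSheet : ∀ b a v, onSheet b a = some v ↔ final a = some (v, b) := by
    intro b a v
    simp only [onSheet, Option.bind_eq_some_iff]
    constructor
    · rintro ⟨⟨w, c⟩, h1, h2⟩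
      simp only at h2
      split_ifs at h2 with h3
      rw [h1, ← h3, Option.some.inj h2]
    · intro h
      exact ⟨(v, b), h, by simp⟩
  have hprob : ∀ b v, (traceChain (walkMatrix L d) (cover U) l ^ k) (s, false) (v, b) =
      unifProb fun a => onSheet b a = some v := by
    intro b v
    simp only [honSheet]
    refine (visitProb_eq_traceChain_pow (walkMatrix L d) (cover U) l k
      (mem_cover.2 hs : (s, false) ∈ cover U) (v, b)).symm.trans ?_
    refine (unifProb_stoppedRun (fun x g => sum_walkMatrix_mul L x g) (cover U) l (k * l) k l ?_
      _ _).symm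
    rcases k with _ | k
    · exact Or.inr rfl
    · left
      rw [add_tsub_cancel_right, Nat.succ_mul]
  refine (half_le_unifProb_collision (onSheet false) (onSheet true)
    (fun v => min ((traceChain (walkMatrix L d) (cover U) l ^ k) (s, false) (v, false))
        ((traceChain (walkMatrix L d) (cover U) l ^ k) (s, false) (v, true)))
    (fun v => le_min (traceChain_pow_nonneg hp _ _ _ _) (traceChain_pow_nonneg hp _ _ _ _))
    (fun v => (min_le_left _ _).trans (hprob false v).le)
    (fun v => (min_le_right _ _).trans (hprob true v).le) hoverlap hn hnV).trans ?_
  refine unifProb_mono ?_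
  rintro ω ⟨i, j, v, h1, h2⟩
  rw [honSheet] at h1 h2
  exact ⟨i, j, v, mem_trajectory_of_stoppedRun _ h1, mem_trajectory_of_stoppedRun _ h2⟩

/-- In a graph that is far from balanced, a round started in a uniformly random vertex has a good
chance to find a conflict: otherwise every large set of vertices contains a vertex from which little
mass is lost and no conflict is found, hence a good cluster, and removing clusters greedily shows that
few modifications suffice. -/
lemma le_card_detecting (hd : G.DegreeLE d) (hd0 : 0 < d) {ε : ℝ} (hε : 0 < ε) (hε1 : ε ≤ 1)
    [Nonempty V] (hfar : FarFrom Balanced d ε G) {l k n : ℕ} (hl : 0 < l)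
    (hlk : 32 * k / ε ≤ l + 1) (hk : (1 - ε ^ 2 / 400) ^ k * (4 * Fintype.card V) < 1) (hn : 0 < n)
    (hnV : Fintype.card V ≤ n ^ 2) :
    ε / 4 * Fintype.card V ≤ #{s | 1 / 2 ≤ unifProb fun ω : RoundSeed d (128 * n) (k * l) =>
      Conflict (L.oracle d) s ω} := by
  by_contra! hcon
  set N := Fintype.card V with hN
  have hN0 : (0 : ℝ) < N := by exact_mod_cast Fintype.card_pos (α := V)
  have hd0' : (0 : ℝ) < d := by exact_mod_cast hd0
  have hp := isLazyReversible_walkMatrix L hd hd0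
  set η := ε ^ 2 / 400 with hη
  have hη0 : 0 < η := by positivity
  have hη1 : η ≤ 1 := by rw [hη]; nlinarith
  have hsqrt : √η = ε / 20 := by
    rw [hη, show ε ^ 2 / 400 = (ε / 20) ^ 2 by ring, Real.sqrt_sq (by positivity)]
  obtain ⟨c, hc⟩ := exists_clustering_of_greedy (G := G) hd (φ := 5 * d * √η) (τ := ε / 2 * N)
    (by positivity) (by positivity) (fun U hU hU0 => by
      -- the vertices of `U` from which much mass is lost are few
      let loss (s : V) : ℝ :=
        1 - ∑ y, (traceChain (walkMatrix L d) (cover U) l ^ k) (s, false) y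
      have hloss0 : ∀ x : V × Bool,
          0 ≤ 1 - ∑ y, (traceChain (walkMatrix L d) (cover U) l ^ k) x y := fun x =>
        sub_nonneg.2 (traceChain_pow_row_sum_le hp l k x)
      have hsum : ∑ s ∈ U, loss s ≤ ε / 16 * N := by
        have h1 := sum_one_sub_traceChain_pow_le (U := cover U) hp l k
        rw [cover, Finset.sum_product] at h1
        have h2 : ∑ s ∈ U, loss s ≤ ∑ s ∈ U, ∑ b : Bool,
            (1 - ∑ y, (traceChain (walkMatrix L d) (cover U) l ^ k) (s, b) y) :=
          Finset.sum_le_sum fun s _ => Finset.single_le_sum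
            (f := fun b : Bool => 1 - ∑ y, (traceChain (walkMatrix L d) (cover U) l ^ k) (s, b) y)
            (fun b _ => hloss0 (s, b)) (Finset.mem_univ false)
        refine (h2.trans h1).trans ?_
        rw [Fintype.card_prod, Fintype.card_bool, ← hN]
        push_cast
        rw [mul_div_assoc', div_le_iff₀ (by positivity)]
        rw [div_le_iff₀ hε] at hlk
        nlinarith
      have hbad : (#{s ∈ U | 1 / 4 < loss s} : ℝ) ≤ ε / 4 * N := by
        have h1 : ∑ s ∈ U with 1 / 4 < loss s, (1 / 4 : ℝ) ≤ ∑ s ∈ U, loss s :=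
          (Finset.sum_le_sum fun s hs => (Finset.mem_filter.1 hs).2.le).trans
            (Finset.sum_le_sum_of_subset_of_nonneg (Finset.filter_subset _ _)
              fun s _ _ => hloss0 (s, false))
        rw [Finset.sum_const, nsmul_eq_mul] at h1
        linarith
      obtain ⟨s, hsU, hs⟩ : ∃ s ∈ U, s ∉ (univ.filter fun s => 1 / 2 ≤ unifProb
          fun ω : RoundSeed d (128 * n) (k * l) => Conflict (L.oracle d) s ω) ∪
          U.filter fun s => 1 / 4 < loss s := by
        refine Finset.exists_mem_notMem_of_card_lt_card ?_
        have h1 := (Nat.cast_le (α := ℝ)).2 (Finset.card_union_le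
          (univ.filter fun s => 1 / 2 ≤ unifProb fun ω : RoundSeed d (128 * n) (k * l) =>
            Conflict (L.oracle d) s ω) (U.filter fun s => 1 / 4 < loss s))
        push_cast at h1
        rw [← Nat.cast_lt (α := ℝ)]
        linarith
      simp only [Finset.mem_union, Finset.mem_filter, Finset.mem_univ, true_and, not_or,
        not_lt, hsU] at hs
      refine exists_cluster_of_small_overlap L hd hd0 U hsU hl k hη0 hη1 hk ?_ ?_
      · have := hs.2
        simp only [loss] at this
        linarith
      · by_contra! h1
        exact hs.1 (half_le_unifProb_conflict L hd0 U hsU l k hn hnV hd h1.le))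
    univ
  simp only [Finset.mem_univ, true_and, Finset.card_univ] at hc
  have h1 := hfar _ (balanced_deleteViolations (G := G) c)
  have h2 := (Nat.cast_le (α := ℝ)).2 (modifications_deleteViolations_le (G := G) c)
  rw [Nat.card_eq_fintype_card, ← hN] at h1
  rw [hsqrt, ← hN] at hc
  have h3 : 0 < ε * d * N := by positivity
  linarith

end SignedGraph

/-! ### The tester as a decision tree -/

namespace SignedGraph

open Finset Classical
open scoped BigOperators

section Trees

variable {V : Type} {d : ℕ}

/-- Deterministic query algorithms for signed graphs on `V`. -/
abbrev Tree (V : Type) (d : ℕ) : Type :=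
  DecisionTree (V × Fin d) (Option (V × SignType))

/-- Walk with the given steps and hand the list of the visited states to the continuation. -/
def walkTree : List (Bool × Fin d) → V × Bool → (List (V × Bool) → Tree V d) → Tree V d
  | [], x, k => k [x]
  | (false, _) :: is, x, k => walkTree is x fun t => k (x :: t)
  | (true, i) :: is, x, k =>
    .query (x.1, i) fun r => walkTree is (follow r x) fun t => k (x :: t)

/-- Make several walks from the same state and hand the list of all visited states to the
continuation. -/
def visitTree (x : V × Bool) :
    List (List (Bool × Fin d)) → (List (V × Bool) → Tree V d) → Tree V d
  | [], k => k []
  | is :: ws, k => walkTree is x fun t => visitTree x ws fun ts => k (t ++ ts)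

/-- One round of the tester: reject if a conflict is found, and continue with `next` otherwise. -/
noncomputable def roundTree {K T : ℕ} (s : V) (ω : RoundSeed d K T) (next : Tree V d) : Tree V d :=
  visitTree (s, false) (List.ofFn fun i => List.ofFn (ω.1 i)) fun A =>
    visitTree (s, false) (List.ofFn fun j => List.ofFn (ω.2 j)) fun B =>
      if ∃ v, (v, false) ∈ A ∧ (v, true) ∈ B then .leaf false else next

/-- The tester for given starting vertices and random choices of all rounds. -/
noncomputable def testTree {K T : ℕ} : List (V × RoundSeed d K T) → Tree V d
  | [] => .leaf true
  | r :: rs => roundTree r.1 r.2 (testTree rs)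

variable (O : V × Fin d → Option (V × SignType))

lemma verdict_walkTree (is : List (Bool × Fin d)) (x : V × Bool)
    (k : List (V × Bool) → Tree V d) :
    (walkTree is x k).verdict O = (k (trajectory (walkStep O) is x)).verdict O := by
  induction is generalizing x k with
  | nil => rfl
  | cons i is ih =>
    rcases i with ⟨_ | _, i⟩
    · rw [walkTree, ih]; rfl
    · rw [walkTree, DecisionTree.verdict, ih]; rfl

lemma queryCount_walkTree_le (is : List (Bool × Fin d)) (x : V × Bool)
    (k : List (V × Bool) → Tree V d) :
    (walkTree is x k).queryCount O ≤
      is.length + (k (trajectory (walkStep O) is x)).queryCount O := by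
  induction is generalizing x k with
  | nil => simp [walkTree, trajectory]
  | cons i is ih =>
    rw [List.length_cons]
    rcases i with ⟨_ | _, i⟩
    · rw [walkTree]
      refine (ih _ _).trans ?_
      rw [trajectory, walkStep, if_neg (by simp)]
      omega
    · rw [walkTree, DecisionTree.queryCount]
      have := ih (follow (O (x.1, i)) x) fun t => k (x :: t)
      have hx : walkStep O (true, i) x = follow (O (x.1, i)) x := rfl
      rw [trajectory, hx]
      omega

lemma verdict_visitTree (x : V × Bool) (ws : List (List (Bool × Fin d)))
    (k : List (V × Bool) → Tree V d) :
    (visitTree x ws k).verdict O =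
      (k (ws.flatMap fun is => trajectory (walkStep O) is x)).verdict O := by
  induction ws generalizing k with
  | nil => rfl
  | cons is ws ih => rw [visitTree, verdict_walkTree, ih, List.flatMap_cons]

lemma queryCount_visitTree_le (x : V × Bool) (ws : List (List (Bool × Fin d))) {T : ℕ}
    (hws : ∀ is ∈ ws, is.length ≤ T) (k : List (V × Bool) → Tree V d) :
    (visitTree x ws k).queryCount O ≤
      ws.length * T + (k (ws.flatMap fun is => trajectory (walkStep O) is x)).queryCount O := by
  induction ws generalizing k with
  | nil => simp [visitTree]
  | cons is ws ih =>
    rw [visitTree, List.flatMap_cons, List.length_cons]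
    refine (queryCount_walkTree_le O _ _ _).trans ?_
    have h1 := ih (fun is h => hws is (List.mem_cons_of_mem _ h))
      fun ts => k (trajectory (walkStep O) is x ++ ts)
    have h2 := hws is List.mem_cons_self
    rw [Nat.succ_mul]
    omega

lemma verdict_roundTree {K T : ℕ} (s : V) (ω : RoundSeed d K T) (next : Tree V d) :
    (roundTree s ω next).verdict O = if Conflict O s ω then false else next.verdict O := by
  rw [roundTree, verdict_visitTree, verdict_visitTree]
  have : (∃ v, (v, false) ∈ (List.ofFn fun i => List.ofFn (ω.1 i)).flatMap
      (fun is => trajectory (walkStep O) is (s, false)) ∧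
      (v, true) ∈ (List.ofFn fun i => List.ofFn (ω.2 i)).flatMap
      (fun is => trajectory (walkStep O) is (s, false))) ↔ Conflict O s ω := by
    simp only [List.mem_flatMap, List.mem_ofFn, Conflict, exists_exists_eq_and]
    constructor
    · rintro ⟨v, ⟨i, hi⟩, j, hj⟩
      exact ⟨i, j, v, hi, hj⟩
    · rintro ⟨i, j, v, hi, hj⟩
      exact ⟨v, ⟨i, hi⟩, j, hj⟩
  by_cases h : Conflict O s ω
  · rw [if_pos h, if_pos (this.2 h), DecisionTree.verdict]
  · rw [if_neg h, if_neg fun h' => h (this.1 h')]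

lemma queryCount_roundTree_le {K T : ℕ} (s : V) (ω : RoundSeed d K T) (next : Tree V d) :
    (roundTree s ω next).queryCount O ≤ 2 * K * T + next.queryCount O := by
  rw [roundTree]
  refine (queryCount_visitTree_le O _ _ (T := T) ?_ _).trans ?_
  · simp [List.mem_ofFn]
  have h : ∀ A : List (V × Bool), (visitTree (s, false) (List.ofFn fun j => List.ofFn (ω.2 j))
      fun B => if ∃ v, (v, false) ∈ A ∧ (v, true) ∈ B then .leaf false else next).queryCount O ≤
      K * T + next.queryCount O := by
    intro A
    refine (queryCount_visitTree_le O _ _ (T := T) ?_ _).trans ?_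
    · simp [List.mem_ofFn]
    rw [List.length_ofFn]
    split_ifs
    · simp [DecisionTree.queryCount]
    · exact le_rfl
  refine (Nat.add_le_add_left (h _) _).trans (le_of_eq ?_)
  rw [List.length_ofFn]
  ring

lemma verdict_testTree_eq_false_iff {K T : ℕ} (rs : List (V × RoundSeed d K T)) :
    (testTree rs).verdict O = false ↔ ∃ r ∈ rs, Conflict O r.1 r.2 := by
  induction rs with
  | nil => simp [testTree, DecisionTree.verdict]
  | cons r rs ih =>
    rw [testTree, verdict_roundTree]
    split_ifs with h <;> simp [h, ih]

lemma queryCount_testTree_le {K T : ℕ} (rs : List (V × RoundSeed d K T)) :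
    (testTree rs).queryCount O ≤ rs.length * (2 * K * T) := by
  induction rs with
  | nil => simp [testTree, DecisionTree.queryCount]
  | cons r rs ih =>
    rw [testTree, List.length_cons, Nat.succ_mul]
    have := queryCount_roundTree_le O r.1 r.2 (testTree rs)
    omega

end Trees

variable {V : Type} {G : SignedGraph V} (L : G.AdjacencyList) {d : ℕ}

/-- A balancing clustering determines the sheet along a walk. -/
lemma xor_walkStep {c : V → Bool} (hc : ∀ u v : V, (G.label s(u, v) = 1 → c u = c v) ∧
    (G.label s(u, v) = -1 → c u ≠ c v)) (i : Bool × Fin d) (x : V × Bool) :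
    xor (walkStep (L.oracle d) i x).2 (c (walkStep (L.oracle d) i x).1) = xor x.2 (c x.1) := by
  unfold walkStep
  split_ifs
  · rw [AdjacencyList.oracle]
    rcases h : (L.list x.1)[(i.2 : ℕ)]? with _ | w
    · rfl
    · have h0 : G.label s(x.1, w) ≠ 0 := (L.mem_list _ _).1 (List.mem_of_getElem? h)
      simp only [Option.map_some, follow]
      rcases hσ : G.label s(x.1, w) with _ | _ | _
      · exact absurd hσ h0
      · have := (hc x.1 w).2 hσ
        have h1 : c w = !c x.1 := by
          cases h2 : c w <;> cases h3 : c x.1 <;> simp_all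
        rw [h1]
        cases x.2 <;> cases c x.1 <;> rfl
      · rw [(hc x.1 w).1 hσ]
        cases x.2 <;> cases c w <;> rfl
  · rfl

lemma xor_of_mem_trajectory {c : V → Bool} (hc : ∀ u v : V, (G.label s(u, v) = 1 → c u = c v) ∧
    (G.label s(u, v) = -1 → c u ≠ c v)) (is : List (Bool × Fin d)) {x y : V × Bool}
    (hy : y ∈ trajectory (walkStep (L.oracle d)) is x) : xor y.2 (c y.1) = xor x.2 (c x.1) := by
  induction is generalizing x with
  | nil =>
    rw [trajectory, List.mem_singleton] at hy
    rw [hy]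
  | cons i is ih =>
    rw [trajectory, List.mem_cons] at hy
    rcases hy with rfl | hy
    · rfl
    · rw [ih hy, xor_walkStep L hc]

lemma not_conflict_of_balanced (hG : G.Balanced) {K T : ℕ} (s : V) (ω : RoundSeed d K T) :
    ¬ Conflict (L.oracle d) s ω := by
  obtain ⟨c, hc⟩ := hG
  rintro ⟨i, j, v, h1, h2⟩
  have h3 := (xor_of_mem_trajectory L hc _ h1).trans (xor_of_mem_trajectory L hc _ h2).symm
  simp only at h3
  cases hv : c v <;> simp [hv] at h3

end SignedGraph

/-- A map of the uniform distribution has the expected probabilities. -/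
lemma PMF.map_uniformOfFintype_apply {Ω β : Type*} [Fintype Ω] [Nonempty Ω] (f : Ω → β) (b : β) :
    (PMF.uniformOfFintype Ω).map f b = ENNReal.ofReal (unifProb fun ω => f ω = b) := by
  classical
  rw [PMF.map_apply, tsum_fintype, unifProb_eq_card_div, ENNReal.ofReal_div_of_pos (by
    exact_mod_cast Fintype.card_pos), ENNReal.ofReal_natCast, ENNReal.ofReal_natCast,
    div_eq_mul_inv]
  simp only [PMF.uniformOfFintype_apply]
  rw [← Finset.sum_filter, Finset.sum_const, nsmul_eq_mul]
  simp only [eq_comm]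

namespace SignedGraphAlgorithm

open SignedGraph Finset

/-- The tester with `R` rounds, each with two batches of `K` walks with `T` steps. -/
noncomputable def walkTester (N d R K T : ℕ) [NeZero N] [NeZero d] : SignedGraphAlgorithm N d :=
  (PMF.uniformOfFintype (Fin R → Fin N × RoundSeed d K T)).map fun ω => testTree (List.ofFn ω)

variable {N d R K T : ℕ} [NeZero N] [NeZero d]

lemma outcome_walkTester {G : SignedGraph (Fin N)} (L : G.AdjacencyList) (b : Bool) :
    (walkTester N d R K T).outcome L b = ENNReal.ofReal (unifProb
      fun ω : Fin R → Fin N × RoundSeed d K T =>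
        (testTree (List.ofFn ω)).verdict (L.oracle d) = b) := by
  rw [outcome, walkTester, PMF.map_comp, PMF.map_uniformOfFintype_apply]
  rfl

lemma walkTester_queryComplexityLE {B : ℝ} (hB : (R * (2 * K * T) : ℕ) ≤ B) :
    (walkTester N d R K T).QueryComplexityLE B := by
  intro G L _ t ht
  rw [walkTester, PMF.mem_support_map_iff] at ht
  obtain ⟨ω, -, rfl⟩ := ht
  refine le_trans ?_ hB
  have := queryCount_testTree_le (L.oracle d) (List.ofFn ω)
  rw [List.length_ofFn] at this
  exact_mod_cast this

lemma walkTester_accepts {G : SignedGraph (Fin N)} (L : G.AdjacencyList) (hG : G.Balanced) :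
    (walkTester N d R K T).outcome L true = 1 := by
  rw [outcome_walkTester]
  have : ∀ ω : Fin R → Fin N × RoundSeed d K T,
      (testTree (List.ofFn ω)).verdict (L.oracle d) = true := fun ω => by
    rw [← Bool.not_eq_false, verdict_testTree_eq_false_iff]
    rintro ⟨r, -, hr⟩
    exact not_conflict_of_balanced L hG _ _ hr
  simp only [this, unifProb, if_true, Fintype.expect_const, ENNReal.ofReal_one]

/-- If a single round finds a conflict with probability at least `q`, then `R` independent rounds
miss all conflicts with probability at most `(1 - q) ^ R`. -/
lemma le_outcome_walkTester {G : SignedGraph (Fin N)} (L : G.AdjacencyList) {q : ℝ}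
    (hq : q ≤ unifProb fun r : Fin N × RoundSeed d K T => Conflict (L.oracle d) r.1 r.2) :
    ENNReal.ofReal (1 - (1 - q) ^ R) ≤ (walkTester N d R K T).outcome L false := by
  rw [outcome_walkTester]
  refine ENNReal.ofReal_le_ofReal ?_
  simp only [verdict_testTree_eq_false_iff, List.mem_ofFn, exists_exists_eq_and]
  have h1 := unifProb_forall R fun r : Fin N × RoundSeed d K T =>
    ¬ Conflict (L.oracle d) r.1 r.2
  have h2 := unifProb_not fun ω : Fin R → Fin N × RoundSeed d K T =>
    ∃ i, Conflict (L.oracle d) (ω i).1 (ω i).2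
  simp only [not_exists] at h2
  rw [h2, unifProb_not] at h1
  have h3 := pow_le_pow_left₀ (sub_nonneg.2 (unifProb_le_one
    fun r : Fin N × RoundSeed d K T => Conflict (L.oracle d) r.1 r.2)) (sub_le_sub_left hq 1) R
  linarith

end SignedGraphAlgorithm

/-! ### Numerical parameters -/

namespace SignedGraph

open Finset Classical
open scoped BigOperators

variable {V : Type} [Fintype V] {G : SignedGraph V} {d : ℕ}

lemma card_edges_le (hd : G.DegreeLE d) :
    (#{e : V × V | G.label s(e.1, e.2) ≠ 0} : ℝ) ≤ d * Fintype.card V := by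
  have := sum_edges_le hd (fun _ => (1 : ℝ)) fun _ => zero_le_one
  simpa using this

/-- There are at most `d * |V|` edges, and deleting all violating edges makes a graph balanced, so
nothing is `ε`-far from balanced if `ε` exceeds one. -/
lemma not_farFrom_balanced_of_one_lt [Nonempty V] (hd : G.DegreeLE d) (hd0 : 0 < d) {ε : ℝ}
    (hε : 1 < ε) : ¬ FarFrom Balanced d ε G := by
  intro h
  have h1 := h _ (balanced_deleteViolations (G := G) fun _ => true)
  have h2 := (Nat.cast_le (α := ℝ)).2 (modifications_deleteViolations_le (G := G) fun _ => true)
  have h3 : #{e : V × V | G.Violates (fun _ => true) e.1 e.2} ≤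
      #{e : V × V | G.label s(e.1, e.2) ≠ 0} :=
    Finset.card_le_card fun e he => by
      rw [Finset.mem_filter] at he ⊢
      exact ⟨he.1, he.2.label_ne_zero⟩
  have h4 := (Nat.cast_le (α := ℝ)).2 h3
  have h5 := card_edges_le hd
  rw [Nat.card_eq_fintype_card] at h1
  have h6 : (0 : ℝ) < d * Fintype.card V :=
    mul_pos (by exact_mod_cast hd0) (by exact_mod_cast Fintype.card_pos)
  nlinarith

end SignedGraph

namespace SignedGraphAlgorithm

open SignedGraph Finset

lemma exists_tester_of_one_lt {N d : ℕ} (hN : 0 < N) (hd : 0 < d) {ε : ℝ} (hε : 1 < ε) {B : ℝ}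
    (hB : 0 ≤ B) : ∃ T : SignedGraphAlgorithm N d,
      T.IsOneSidedTester SignedGraph.Balanced ε ∧ T.QueryComplexityLE B := by
  have : NeZero N := ⟨hN.ne'⟩
  refine ⟨PMF.pure (.leaf true), fun G L hG => ⟨fun _ => ?_, fun hfar => ?_⟩, fun G L _ t ht => ?_⟩
  · rw [outcome, PMF.pure_map]
    simp [DecisionTree.verdict]
  · exact absurd hfar (not_farFrom_balanced_of_one_lt hG hd hε)
  · rw [PMF.support_pure, Set.mem_singleton_iff] at ht
    simpa [ht, DecisionTree.queryCount] using hB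

/-- With polynomially many rounds, a multiple of `√N` walks in each round, and walks of
polylogarithmic length, the tester rejects graphs that are far from balanced. -/
lemma walkTester_isOneSidedTester {N d R l k n : ℕ} [NeZero N] [NeZero d] {ε : ℝ} (hε : 0 < ε)
    (hε1 : ε ≤ 1) (hR : 16 / ε ≤ R) (hl : 0 < l) (hlk : 32 * k / ε ≤ l + 1)
    (hk : (1 - ε ^ 2 / 400) ^ k * (4 * N) < 1) (hn : 0 < n) (hnN : N ≤ n ^ 2) :
    (walkTester N d R (128 * n) (k * l)).IsOneSidedTester SignedGraph.Balanced ε := by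
  classical
  intro G L hG
  refine ⟨walkTester_accepts L, fun hfar => ?_⟩
  have hN0 : (0 : ℝ) < N := by exact_mod_cast Nat.pos_of_ne_zero (NeZero.ne N)
  have hround : ε / 8 ≤ unifProb fun r : Fin N × RoundSeed d (128 * n) (k * l) =>
      Conflict (L.oracle d) r.1 r.2 := by
    have h1 := le_card_detecting L hG (Nat.pos_of_ne_zero (NeZero.ne d)) hε hε1 hfar hl hlk
      (by simpa using hk) hn (by simpa using hnN)
    rw [Fintype.card_fin] at h1
    rw [unifProb_prod, Fintype.expect_eq_sum_div_card, Fintype.card_fin, le_div_iff₀ hN0]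
    refine le_trans ?_ (Finset.sum_le_sum_of_subset_of_nonneg (Finset.filter_subset
      (fun s => 1 / 2 ≤ unifProb fun ω : RoundSeed d (128 * n) (k * l) =>
        Conflict (L.oracle d) s ω) univ) fun s _ _ => unifProb_nonneg _)
    refine le_trans ?_ (Finset.card_nsmul_le_sum _ _ (1 / 2) fun s hs =>
      (Finset.mem_filter.1 hs).2)
    rw [nsmul_eq_mul]
    linarith
  refine le_trans ?_ (le_outcome_walkTester L hround)
  rw [show (2 / 3 : ENNReal) = ENNReal.ofReal (2 / 3) by
    rw [ENNReal.ofReal_div_of_pos (by norm_num)]; norm_num]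
  refine ENNReal.ofReal_le_ofReal ?_
  have h1 : (1 - ε / 8) ^ R ≤ Real.exp (-2) := by
    refine (pow_le_pow_left₀ (by linarith) (Real.one_sub_le_exp_neg (ε / 8)) R).trans ?_
    rw [← Real.exp_nat_mul]
    refine Real.exp_le_exp.2 ?_
    rw [div_le_iff₀ hε] at hR
    linarith
  have h2 : Real.exp (-2) ≤ 1 / 3 := by
    rw [Real.exp_neg, one_div]
    exact inv_anti₀ (by norm_num) (by linarith [Real.add_one_le_exp (2 : ℝ)])
  linarith

lemma exists_tester_of_le_one {N d : ℕ} (hN : 0 < N) (hd : 0 < d) {ε : ℝ} (hε : 0 < ε)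
    (hε1 : ε ≤ 1) : ∃ T : SignedGraphAlgorithm N d,
      T.IsOneSidedTester SignedGraph.Balanced ε ∧
      T.QueryComplexityLE (500000000000 * (1 + Real.log N) ^ 2 * √N / ε ^ 6) := by
  have : NeZero N := ⟨hN.ne'⟩
  have : NeZero d := ⟨hd.ne'⟩
  have hN1 : (1 : ℝ) ≤ N := by exact_mod_cast hN
  set Λ := 1 + Real.log N with hΛ
  have hΛ1 : 1 ≤ Λ := by linarith [Real.log_nonneg hN1]
  have hlog : Real.log (8 * N) ≤ 3 * Λ := by
    rw [Real.log_mul (by norm_num) (by positivity), show (8 : ℝ) = 2 ^ 3 by norm_num, Real.log_pow]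
    push_cast
    linarith [Real.log_two_lt_d9, Real.log_nonneg hN1]
  -- `k` steps of the trace chain make `(1 - ε ^ 2 / 400) ^ k` smaller than `1 / (8 * N)`; excursions of
  -- length up to `l` keep the loss of mass in these steps small; `R` rounds amplify the probability
  -- `ε / 8` that a single round finds a conflict
  set k := ⌈400 * Real.log (8 * N) / ε ^ 2⌉₊ with hk
  set l := ⌈32 * k / ε⌉₊ + 1 with hl
  set R := ⌈16 / ε⌉₊ with hR
  set n := Nat.sqrt N + 1 with hn
  have hε2 : ε ^ 2 ≤ 1 := pow_le_one₀ hε.le hε1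
  have hε3 : ε ^ 3 ≤ 1 := pow_le_one₀ hε.le hε1
  have hlog0 : 0 ≤ Real.log (8 * N) := Real.log_nonneg (by linarith)
  have hkle : (k : ℝ) ≤ 1201 * Λ / ε ^ 2 := by
    have h1 := (Nat.ceil_lt_add_one (show 0 ≤ 400 * Real.log (8 * N) / ε ^ 2 by positivity)).le
    rw [← hk] at h1
    refine h1.trans ?_
    rw [div_add_one (by positivity), div_le_div_iff_of_pos_right (by positivity)]
    linarith
  have hlle : (l : ℝ) ≤ 38434 * Λ / ε ^ 3 := by
    have h1 := (Nat.ceil_lt_add_one (show 0 ≤ 32 * (k : ℝ) / ε by positivity)).le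
    have h2 : 32 * (k : ℝ) / ε ≤ 38432 * Λ / ε ^ 3 := by
      calc 32 * (k : ℝ) / ε ≤ 32 * (1201 * Λ / ε ^ 2) / ε := by gcongr
        _ = _ := by field_simp; norm_num
    have h3 : 2 ≤ 2 * Λ / ε ^ 3 := by
      rw [le_div_iff₀ (by positivity)]
      nlinarith
    rw [hl]
    push_cast
    have h4 : 38434 * Λ / ε ^ 3 = 38432 * Λ / ε ^ 3 + 2 * Λ / ε ^ 3 := by ring
    linarith
  have hRle : (R : ℝ) ≤ 17 / ε := by
    have h1 := (Nat.ceil_lt_add_one (show 0 ≤ 16 / ε by positivity)).le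
    rw [← hR] at h1
    refine h1.trans ?_
    rw [div_add_one hε.ne', div_le_div_iff_of_pos_right hε]
    linarith
  have hnle : (n : ℝ) ≤ 2 * √N := by
    have h1 : (Nat.sqrt N : ℝ) ≤ √N := Real.nat_sqrt_le_real_sqrt
    have h2 : 1 ≤ √(N : ℝ) := Real.one_le_sqrt.2 hN1
    rw [hn]
    push_cast
    linarith
  refine ⟨walkTester N d R (128 * n) (k * l), walkTester_isOneSidedTester hε hε1 (Nat.le_ceil _)
    (Nat.succ_pos _) ?_ ?_ (Nat.succ_pos _) ?_, walkTester_queryComplexityLE ?_⟩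
  · have := Nat.le_ceil (32 * (k : ℝ) / ε)
    rw [hl]
    push_cast
    linarith
  · have h1 : (1 - ε ^ 2 / 400) ^ k ≤ 1 / (8 * N) := by
      refine (pow_le_pow_left₀ (by linarith) (Real.one_sub_le_exp_neg _) k).trans ?_
      have h8 : 1 / (8 * N : ℝ) = Real.exp (-Real.log (8 * N)) := by
        rw [Real.exp_neg, Real.exp_log (by positivity), one_div]
      rw [← Real.exp_nat_mul, h8]
      refine Real.exp_le_exp.2 ?_
      have := Nat.le_ceil (400 * Real.log (8 * N) / ε ^ 2)
      rw [div_le_iff₀ (by positivity)] at this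
      linarith
    calc (1 - ε ^ 2 / 400) ^ k * (4 * N) ≤ 1 / (8 * N) * (4 * N) := by gcongr
      _ = 1 / 2 := by field_simp; norm_num
      _ < 1 := by norm_num
  · rw [sq]
    exact (Nat.lt_succ_sqrt N).le
  · push_cast
    have h0 : (0 : ℝ) ≤ √N := Real.sqrt_nonneg _
    calc (R : ℝ) * (2 * (128 * n) * (k * l)) ≤ 17 / ε * (2 * (128 * (2 * √N)) *
          (1201 * Λ / ε ^ 2 * (38434 * Λ / ε ^ 3))) := by gcongr
      _ = 401769972736 * Λ ^ 2 * √N / ε ^ 6 := by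
        field_simp
        ring
      _ ≤ 500000000000 * Λ ^ 2 * √N / ε ^ 6 := by
        gcongr
        norm_num

end SignedGraphAlgorithm

/-! ### Subdividing the positive edges -/

namespace SignedGraph

variable {V : Type} {G : SignedGraph V}

lemma cluster_eq_of_mem {c : V → Bool} (hc : ∀ u v : V, G.label s(u, v) = 1 → c u = c v)
    {e : Sym2 V} (he : G.label e = 1) {x y : V} (hx : x ∈ e) (hy : y ∈ e) : c x = c y := by
  by_cases hxy : x = y
  · rw [hxy]
  · rw [(Sym2.mem_and_mem_iff hxy).1 ⟨hx, hy⟩] at he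
    exact hc x y he

/-- The clustering given by the colours of the original vertices. -/
def clusterOfColoring {α : Type*} {H : SimpleGraph (V ⊕ α)} (C : H.Coloring (Fin 2)) (v : V) :
    Bool :=
  decide (C (.inl v) = 0)

lemma clusterOfColoring_eq_iff {α : Type*} {H : SimpleGraph (V ⊕ α)} (C : H.Coloring (Fin 2))
    (u v : V) : clusterOfColoring C u = clusterOfColoring C v ↔ C (.inl u) = C (.inl v) := by
  simp only [clusterOfColoring, decide_eq_decide]
  omega

/-- Two vertices with a common neighbour have the same colour. -/
lemma clusterOfColoring_eq_of_adj {α : Type*} {H : SimpleGraph (V ⊕ α)} (C : H.Coloring (Fin 2))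
    {u v : V} {x : V ⊕ α} (hu : H.Adj (.inl u) x) (hv : H.Adj (.inl v) x) :
    clusterOfColoring C u = clusterOfColoring C v := by
  rw [clusterOfColoring_eq_iff]
  have h1 := C.valid hu
  have h2 := C.valid hv
  omega

theorem balanced_iff_isBipartite_subdivision : G.Balanced ↔ G.subdivision.IsBipartite := by
  constructor
  · rintro ⟨c, hc⟩
    let color : V ⊕ {e : Sym2 V // G.label e = 1} → Bool
      | .inl v => c v
      | .inr e => !c e.1.out.1
    have hmid : ∀ (v : V) (e : {e : Sym2 V // G.label e = 1}), v ∈ e.1 →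
        color (.inl v) ≠ color (.inr e) := by
      intro v e h
      have : c v = c e.1.out.1 :=
        cluster_eq_of_mem (fun u v => (hc u v).1) e.2 h (Sym2.out_fst_mem _)
      simp [color, this]
    have C : G.subdivision.Coloring Bool := SimpleGraph.Coloring.mk color (by
      rintro (u | e) (v | f) h
      · exact (hc u v).2 h
      · exact hmid u f h
      · exact (hmid v e h).symm
      · exact h.elim)
    exact C.colorable
  · rintro ⟨C⟩
    refine ⟨clusterOfColoring C, fun u v => ⟨fun h => ?_, fun h => ?_⟩⟩
    · exact clusterOfColoring_eq_of_adj C (x := .inr ⟨s(u, v), h⟩)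
        (show u ∈ s(u, v) from Sym2.mem_mk_left u v) (show v ∈ s(u, v) from Sym2.mem_mk_right u v)
    · rw [ne_eq, clusterOfColoring_eq_iff]
      exact C.valid (show G.subdivision.Adj (.inl u) (.inl v) from h)

/-- Every violating edge of `G` leaves a trace in `G.subdivision`, the edge itself or one half of its
subdivision, that is missing in the bipartite graph `H`. -/
lemma modifications_le_ncard_symmDiff [Finite V]
    {H : SimpleGraph (V ⊕ {e : Sym2 V // G.label e = 1})} (C : H.Coloring (Fin 2)) :
    G.modifications (G.deleteViolations (clusterOfColoring C)) ≤
      (symmDiff G.subdivision.edgeSet H.edgeSet).ncard := by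
  set A : Set (Sym2 V) :=
    {e | G.label e ≠ (G.deleteViolations (clusterOfColoring C)).label e} with hA
  have key : ∀ e : Sym2 V, ∃ f : Sym2 (V ⊕ {e : Sym2 V // G.label e = 1}), e ∈ A →
      f ∈ symmDiff G.subdivision.edgeSet H.edgeSet ∧ (f = e.map .inl ∨
        ∃ (x : V) (h : G.label e = 1), f = s(.inl x, .inr ⟨e, h⟩)) := by
    intro e
    by_cases he : e ∈ A
    swap
    · exact ⟨e.map .inl, fun h => absurd h he⟩
    suffices h : ∃ f ∈ symmDiff G.subdivision.edgeSet H.edgeSet, f = e.map .inl ∨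
        ∃ (x : V) (h : G.label e = 1), f = s(.inl x, .inr ⟨e, h⟩) from h.imp fun _ hf _ => hf
    simp only [hA, deleteViolations, Set.mem_ofPred_eq] at he
    split_ifs at he with h
    · obtain ⟨u, v, rfl, h | h⟩ := h
      · -- one half of the subdivided edge is missing in `H`
        have h1 : ¬ (H.Adj (.inl u) (.inr ⟨s(u, v), h.1⟩) ∧ H.Adj (.inl v) (.inr ⟨s(u, v), h.1⟩)) :=
          fun h2 => h.2 (clusterOfColoring_eq_of_adj C h2.1 h2.2)
        have h2 : ∀ x ∈ s(u, v), ¬ H.Adj (.inl x) (.inr ⟨s(u, v), h.1⟩) →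
            s(.inl x, .inr ⟨s(u, v), h.1⟩) ∈ symmDiff G.subdivision.edgeSet H.edgeSet :=
          fun x hx hxH => Or.inl ⟨hx, hxH⟩
        rw [not_and_or] at h1
        rcases h1 with h1 | h1
        · exact ⟨_, h2 u (Sym2.mem_mk_left u v) h1, Or.inr ⟨u, h.1, rfl⟩⟩
        · exact ⟨_, h2 v (Sym2.mem_mk_right u v) h1, Or.inr ⟨v, h.1, rfl⟩⟩
      · refine ⟨s(.inl u, .inl v), Or.inl ⟨h.1, fun h2 => ?_⟩, Or.inl rfl⟩
        exact C.valid h2 ((clusterOfColoring_eq_iff C u v).1 h.2)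
    · exact absurd rfl he
  choose f hf using key
  refine Set.ncard_le_ncard_of_injOn f (fun e he => (hf e he).1) ?_ (Set.toFinite _)
  have hne : ∀ (e : Sym2 V) (x : V) (y : {e : Sym2 V // G.label e = 1}),
      e.map Sum.inl ≠ s(Sum.inl x, Sum.inr y) := by
    intro e x y h
    have h1 : Sum.inr y ∈ e.map Sum.inl := h ▸ Sym2.mem_mk_right _ _
    rw [Sym2.mem_map] at h1
    obtain ⟨z, -, hz⟩ := h1
    cases hz
  intro e₁ he₁ e₂ he₂ h12
  rcases (hf e₁ he₁).2 with h1 | ⟨x₁, hx₁, h1⟩ <;> rcases (hf e₂ he₂).2 with h2 | ⟨x₂, hx₂, h2⟩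
  · exact Sym2.map.injective Sum.inl_injective (h1.symm.trans (h12.trans h2))
  · exact absurd (h1.symm.trans (h12.trans h2)) (hne _ _ _)
  · exact absurd (h2.symm.trans (h12.symm.trans h1)) (hne _ _ _)
  · have h3 := h1.symm.trans (h12.trans h2)
    rw [Sym2.eq_iff] at h3
    rcases h3 with h3 | h3
    · exact congrArg Subtype.val (Sum.inr_injective h3.2)
    · exact absurd h3.1 (by simp)

lemma card_subdivision_le [Fintype V] {d : ℕ} (hd : G.DegreeLE d) :
    (Nat.card (V ⊕ {e : Sym2 V // G.label e = 1}) : ℝ) ≤ (d + 1) * Nat.card V := by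
  classical
  have h1 : Nat.card {e : Sym2 V // G.label e = 1} ≤
      (Finset.univ.filter fun e : V × V => G.label s(e.1, e.2) ≠ 0).card := by
    rw [Nat.card_eq_fintype_card, Fintype.card_subtype]
    refine Finset.card_le_card_of_surjOn (fun e : V × V => s(e.1, e.2)) fun e he => ?_
    induction e using Sym2.ind with
    | _ u v =>
      refine ⟨(u, v), ?_, rfl⟩
      simp only [Finset.coe_filter, Finset.mem_univ, true_and, Set.mem_ofPred_eq] at he ⊢
      rw [he]
      decide
  have h2 := card_edges_le hd
  have h3 : (Nat.card {e : Sym2 V // G.label e = 1} : ℝ) ≤ d * Fintype.card V :=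
    ((Nat.cast_le (α := ℝ)).2 h1).trans (by convert h2)
  rw [Nat.card_sum]
  push_cast
  rw [Nat.card_eq_fintype_card (α := V)]
  linarith

theorem farFromBipartite_subdivision [Fintype V] {d : ℕ} {ε : ℝ} (hε : 0 < ε) (hd : G.DegreeLE d)
    (h : FarFrom Balanced d ε G) : G.subdivision.FarFromBipartite d (ε / (d + 1)) := by
  rintro H ⟨C⟩
  have h1 := h _ (balanced_deleteViolations (G := G) (clusterOfColoring C))
  have h2 := (Nat.cast_le (α := ℝ)).2 (modifications_le_ncard_symmDiff C)
  refine le_trans ?_ (h1.trans h2)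
  calc ε / (d + 1) * d * Nat.card (V ⊕ {e : Sym2 V // G.label e = 1})
      ≤ ε / (d + 1) * d * ((d + 1) * Nat.card V) := by
        gcongr
        exact card_subdivision_le hd
    _ = ε * d * Nat.card V := by field_simp

end SignedGraph

theorem mainTheorem2 :
    (∃ (C : ℝ) (a b c : ℕ), ∀ (N d : ℕ) (ε : ℝ), 0 < N → 0 < d → 0 < ε →
      ∃ T : SignedGraphAlgorithm N d,
        T.IsOneSidedTester SignedGraph.Balanced ε ∧
        T.QueryComplexityLE
          (C * (d : ℝ) ^ a * (1 + Real.log N) ^ c * Real.sqrt N / ε ^ b)) ∧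
    (∀ (N d : ℕ) (ε : ℝ) (G : SignedGraph (Fin N)), 0 < ε → G.DegreeLE d →
      (G.Balanced ↔ G.subdivision.IsBipartite) ∧
      (SignedGraph.FarFrom SignedGraph.Balanced d ε G →
        SimpleGraph.FarFromBipartite d (ε / (d + 1)) G.subdivision)) := by
  refine ⟨⟨500000000000, 0, 6, 2, fun N d ε hN hd hε => ?_⟩, fun N d ε G hε hd =>
    ⟨SignedGraph.balanced_iff_isBipartite_subdivision,
      SignedGraph.farFromBipartite_subdivision hε hd⟩⟩
  rw [pow_zero, mul_one]
  rcases le_or_gt ε 1 with hε1 | hε1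
  · exact SignedGraphAlgorithm.exists_tester_of_le_one hN hd hε hε1
  · refine SignedGraphAlgorithm.exists_tester_of_one_lt hN hd hε1 ?_
    have : 0 ≤ Real.log N := Real.log_natCast_nonneg N
    positivity
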